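/- Let $k$ be an algebraically closed field of characteristic $p>0$; all $k$-algebras are commutative and unital. Let $R$ be a $k$-algebra essentially of finite type, and let $A$ be a local artinian $k$-algebra with maximal ideal $\mathfrak m_A$ and residue field $k$ (that is, $k\to A/\mathfrak m_A$ is an isomorphism). Let $\operatorname{HS}^A(R)$ denote the group (under composition) of $A$-algebra automorphisms of $A\otimes_k R$ that induce the identity on $(A/\mathfrak m_A)\otimes_k R$. For $n\ge 0$ let $\operatorname{HS}^n(R)$ denote the set of Hasse–Schmidt derivations of length $n$, that is, of sequences $E=(E_0,\dots,E_n)$ of $k$-linear maps $R\to R$ with $E_0=\operatorname{id}$ and $E_i(xy)=\sum_{j+l=i}E_j(x)E_l(y)$ for all $x,y\in R$ and $0\le i\le n$. Such a sequence is identified with the element of $\operatorname{HS}^{k[\varepsilon]/(\varepsilon^{n+1})}(R)$ given by $1\otimes x\mapsto\sum_{i=0}^n\varepsilon^i\otimes E_i(x)$. For $y\in\mathfrak m_A$ let $r(A,y)$ be the largest integer $r\ge 0$ with $y^r\ne 0$ (so $r(A,0)=0$). For $n\ge r(A,y)$ and $E\in\operatorname{HS}^n(R)$ let $E\langle y\rangle:=f_*(E)=\operatorname{id}_A\otimes_{k[\varepsilon]/(\varepsilon^{n+1})}E\in\operatorname{HS}^A(R)$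 be the pushforward (base change) of $E$ along the $k$-algebra homomorphism $f:k[\varepsilon]/(\varepsilon^{n+1})\to A$, $\varepsilon\mapsto y$. Then for every $D\in\operatorname{HS}^A(R)$ there exist an integer $m\ge 0$, elements $y_1,\dots,y_m\in\mathfrak m_A$ and Hasse–Schmidt derivations $D^i\in\operatorname{HS}^{r(A,y_i)}(R)$ for $1\le i\le m$ such that $$D=D^1\langle y_1\rangle\circ\dots\circ D^m\langle y_m\rangle$$ (for $m=0$ the composition is the identity). -/

import Mathlib

open scoped TensorProduct

noncomputable section

namespace HasseSchmidt

universe u v w w'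

/-- A Hasse-Schmidt derivation of length `n` of the `k`-algebra `R`: a sequence
`(D 0, …, D n)` of `k`-linear endomorphisms of `R` with `D 0 = id` that satisfies the
higher Leibniz rule `D i (x * y) = ∑_{j + l = i} D j x * D l y`. -/
structure Derivation (k : Type u) (R : Type v) [Field k] [CommRing R] [Algebra k R]
    (n : ℕ) where
  /-- the components `D 0, …, D n` -/
  coeff : Fin (n + 1) → (R →ₗ[k] R)
  coeff_zero : coeff 0 = LinearMap.id
  leibniz : ∀ (i : Fin (n + 1)) (x y : R),
    coeff i (x * y) =
      ∑ q : Fin (n + 1) × Fin (n + 1) with (q.1 : ℕ) + (q.2 : ℕ) = (i : ℕ),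
        coeff q.1 x * coeff q.2 y

section Extension

variable {k : Type u} {R : Type v} {A : Type w} [Field k] [CommRing R] [Algebra k R]
  [CommRing A] [Algebra k A]

/-- The `A`-linear extension `A ⊗ R → A ⊗ R` of a `k`-algebra homomorphism `R → A ⊗ R`. -/
def extend (f : R →ₐ[k] A ⊗[k] R) : A ⊗[k] R →ₐ[A] A ⊗[k] R :=
  Algebra.TensorProduct.lift (Algebra.ofId A (A ⊗[k] R)) f fun _ _ => Commute.all _ _

theorem extend_tmul (f : R →ₐ[k] A ⊗[k] R) (a : A) (r : R) :
    extend f (a ⊗ₜ[k] r) = a • f r := by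
  rw [extend, Algebra.TensorProduct.lift_tmul, Algebra.ofId_apply, Algebra.smul_def]

end Extension

section Automorphisms

variable (k : Type u) (R : Type v) (A : Type w) [Field k] [CommRing R] [Algebra k R]
  [CommRing A] [Algebra k A] [IsLocalRing A]

/-- The reduction map `A ⊗ R → (A / 𝔪_A) ⊗ R`. -/
def reduction : A ⊗[k] R →ₐ[A] (IsLocalRing.ResidueField A) ⊗[k] R :=
  Algebra.TensorProduct.map (Algebra.ofId A (IsLocalRing.ResidueField A)) (AlgHom.id k R)

/-- The group `HS^A(R)` of deformation automorphisms: the `A`-algebra automorphisms of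
`A ⊗ R` which induce the identity on `(A / 𝔪_A) ⊗ R`. The group law is composition. -/
def HS : Subgroup (A ⊗[k] R ≃ₐ[A] A ⊗[k] R) where
  carrier := {D | ∀ z, reduction k R A (D z) = reduction k R A z}
  one_mem' := fun _ => rfl
  mul_mem' := fun {D E} hD hE z => (hD (E z)).trans (hE z)
  inv_mem' := fun {D} hD z => by
    have h := hD (D⁻¹ z)
    rw [← h]
    exact congrArg _ (D.apply_symm_apply z)

variable {k R A}

theorem reduction_tmul (a : A) (r : R) :
    reduction k R A (a ⊗ₜ[k] r) = IsLocalRing.residue A a ⊗ₜ[k] r := rfl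

theorem sub_mem_of_reduction_eq {z z' : A ⊗[k] R}
    (h : reduction k R A z = reduction k R A z') :
    z - z' ∈ IsLocalRing.maximalIdeal A • (⊤ : Submodule A (A ⊗[k] R)) := by
  have hker : z - z' ∈ RingHom.ker (reduction k R A) := by
    rw [RingHom.mem_ker, map_sub, h, sub_self]
  have hs : Function.Surjective (Algebra.ofId A (IsLocalRing.ResidueField A)) :=
    IsLocalRing.residue_surjective
  rw [reduction, Algebra.TensorProduct.rTensor_ker _ hs] at hker
  have hk : RingHom.ker (Algebra.ofId A (IsLocalRing.ResidueField A)) =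
      IsLocalRing.maximalIdeal A := IsLocalRing.ker_residue
  rw [hk] at hker
  rw [Ideal.smul_top_eq_map]
  exact hker

/-- An `A`-algebra endomorphism of `A ⊗ R` that induces the identity on `(A / 𝔪_A) ⊗ R` is
bijective if `A` is artinian. -/
theorem bijective_of_reduction [IsArtinianRing A] (f : A ⊗[k] R →ₐ[A] A ⊗[k] R)
    (hf : ∀ z, reduction k R A (f z) = reduction k R A z) : Function.Bijective f := by
  let N : Module.End A (A ⊗[k] R) := f.toLinearMap - 1
  have hN : ∀ j : ℕ, ∀ z, (N ^ j) z ∈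
      (IsLocalRing.maximalIdeal A) ^ j • (⊤ : Submodule A (A ⊗[k] R)) := by
    intro j
    induction j with
    | zero =>
      intro z
      rw [pow_zero, Ideal.one_eq_top, Submodule.top_smul]
      trivial
    | succ j ih =>
      intro z
      have h0 : (N ^ (j + 1)) z = (N ^ j) (N z) := by
        rw [pow_succ, Module.End.mul_apply]
      have h1 : N z ∈ IsLocalRing.maximalIdeal A • (⊤ : Submodule A (A ⊗[k] R)) :=
        sub_mem_of_reduction_eq (hf z)
      have h2 : (N ^ j) (N z) ∈ (IsLocalRing.maximalIdeal A •
          (⊤ : Submodule A (A ⊗[k] R))).map (N ^ j) := Submodule.mem_map_of_mem h1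
      rw [Submodule.map_smul''] at h2
      rw [h0, pow_succ', Submodule.mul_smul]
      refine Submodule.smul_mono le_rfl ?_ h2
      rintro _ ⟨y, -, rfl⟩
      exact ih y
  obtain ⟨j, hj⟩ := IsArtinianRing.isNilpotent_jacobson_bot (R := A)
  rw [IsLocalRing.jacobson_eq_maximalIdeal ⊥ bot_ne_top] at hj
  have hnil : IsNilpotent N := ⟨j, LinearMap.ext fun z => by
    have := hN j z
    rw [hj, Ideal.zero_eq_bot, Submodule.bot_smul] at this
    exact this⟩
  have hu : IsUnit (f.toLinearMap : Module.End A (A ⊗[k] R)) := by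
    have := hnil.isUnit_one_add
    rwa [add_sub_cancel] at this
  exact (Module.End.isUnit_iff _).1 hu

theorem reduction_extend (f : R →ₐ[k] A ⊗[k] R)
    (hf : ∀ r, reduction k R A (f r) = 1 ⊗ₜ[k] r) (z : A ⊗[k] R) :
    reduction k R A (extend f z) = reduction k R A z := by
  induction z using TensorProduct.induction_on with
  | zero => rw [map_zero]
  | tmul a r =>
    rw [extend_tmul, map_smul, hf, TensorProduct.smul_tmul', reduction_tmul,
      Algebra.smul_def, mul_one]
    rfl
  | add x y hx hy => rw [map_add, map_add, hx, hy, map_add]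

/-- The element of `HS^A(R)` whose restriction to `R` is a given `k`-algebra homomorphism
`R → A ⊗ R` that reduces to the identity. -/
def HS.ofAlgHom [IsArtinianRing A] (f : R →ₐ[k] A ⊗[k] R)
    (hf : ∀ r, reduction k R A (f r) = 1 ⊗ₜ[k] r) : HS k R A :=
  ⟨AlgEquiv.ofBijective (extend f) (bijective_of_reduction _ (reduction_extend f hf)),
    reduction_extend f hf⟩

end Automorphisms

section Pushforward

variable {k : Type u} {R : Type v} {A' : Type w} {A : Type w'} [Field k] [CommRing R]
  [Algebra k R] [CommRing A'] [Algebra k A'] [CommRing A] [Algebra k A]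

/-- For a `k`-algebra homomorphism `f : A' → A` and an `A'`-algebra automorphism `D` of
`A' ⊗ R`, the `A`-algebra automorphism `id_A ⊗_{A'} D` of `A ⊗_{A'} (A' ⊗ R) ≃ A ⊗ R`. -/
def baseChange (f : A' →ₐ[k] A) (D : A' ⊗[k] R ≃ₐ[A'] A' ⊗[k] R) :
    A ⊗[k] R ≃ₐ[A] A ⊗[k] R :=
  letI : Algebra A' A := f.toRingHom.toAlgebra
  haveI : IsScalarTower k A' A := IsScalarTower.of_algebraMap_eq fun x => (f.commutes x).symm
  let e : A ⊗[A'] (A' ⊗[k] R) ≃ₐ[A] A ⊗[k] R :=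
    Algebra.TensorProduct.cancelBaseChange k A' A A R
  (e.symm.trans (Algebra.TensorProduct.congr AlgEquiv.refl D)).trans e

theorem baseChange_tmul (f : A' →ₐ[k] A) (D : A' ⊗[k] R ≃ₐ[A'] A' ⊗[k] R) (a : A) (r : R) :
    baseChange f D (a ⊗ₜ[k] r) =
      a • Algebra.TensorProduct.map f (AlgHom.id k R) (D (1 ⊗ₜ[k] r)) := by
  let _ : Algebra A' A := f.toRingHom.toAlgebra
  have _ : IsScalarTower k A' A := IsScalarTower.of_algebraMap_eq fun x => (f.commutes x).symm
  have key : ∀ z : A' ⊗[k] R, Algebra.TensorProduct.cancelBaseChange k A' A A R (a ⊗ₜ z) =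
      a • Algebra.TensorProduct.map f (AlgHom.id k R) z := by
    intro z
    induction z using TensorProduct.induction_on with
    | zero => rw [TensorProduct.tmul_zero, map_zero, map_zero, smul_zero]
    | tmul b s =>
      rw [Algebra.TensorProduct.cancelBaseChange_tmul, Algebra.TensorProduct.map_tmul,
        TensorProduct.smul_tmul', smul_eq_mul, Algebra.smul_def, mul_comm]
      rfl
    | add x y hx hy => rw [TensorProduct.tmul_add, map_add, hx, hy, map_add, smul_add]
  exact key _

variable [IsLocalRing A'] [IsLocalRing A]

theorem reduction_map_eq (f : A' →ₐ[k] A) [IsLocalHom f] {z z' : A' ⊗[k] R}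
    (h : reduction k R A' z = reduction k R A' z') :
    reduction k R A (Algebra.TensorProduct.map f (AlgHom.id k R) z) =
      reduction k R A (Algebra.TensorProduct.map f (AlgHom.id k R) z') := by
  have hm := sub_mem_of_reduction_eq h
  rw [Ideal.smul_top_eq_map] at hm
  have hm' : z - z' ∈ (IsLocalRing.maximalIdeal A').map (algebraMap A' (A' ⊗[k] R)) := hm
  let g : A' ⊗[k] R →+* IsLocalRing.ResidueField A ⊗[k] R :=
    (reduction k R A).toRingHom.comp (Algebra.TensorProduct.map f (AlgHom.id k R)).toRingHom
  have hle : (IsLocalRing.maximalIdeal A').map (algebraMap A' (A' ⊗[k] R)) ≤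
      RingHom.ker g := by
    rw [Ideal.map_le_iff_le_comap]
    intro b hb
    have hfb : f b ∈ IsLocalRing.maximalIdeal A := fun hu => hb (IsUnit.of_map f b hu)
    have : g (b ⊗ₜ[k] (1 : R)) = 0 := by
      change IsLocalRing.residue A (f b) ⊗ₜ[k] (1 : R) = 0
      rw [(IsLocalRing.residue_eq_zero_iff _).2 hfb, TensorProduct.zero_tmul]
    exact this
  have h0 : g (z - z') = 0 := hle hm'
  rw [map_sub, sub_eq_zero] at h0
  exact h0

theorem baseChange_mem (f : A' →ₐ[k] A) [IsLocalHom f] (D : HS k R A') :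
    baseChange f D.1 ∈ HS k R A := by
  intro z
  induction z using TensorProduct.induction_on with
  | zero => rw [map_zero]
  | tmul a r =>
    rw [baseChange_tmul, map_smul, reduction_map_eq f (D.2 (1 ⊗ₜ[k] r)),
      Algebra.TensorProduct.map_tmul, map_one, ← map_smul, TensorProduct.smul_tmul',
      smul_eq_mul, mul_one]
    rfl
  | add x y hx hy => rw [map_add, map_add, hx, hy, map_add]

/-- The map `f_* : HS^{A'}(R) → HS^A(R)` for a local homomorphism `f : A' → A` of local
`k`-algebras. -/
def pushforward (f : A' →ₐ[k] A) [IsLocalHom f] (D : HS k R A') : HS k R A :=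
  ⟨baseChange f D.1, baseChange_mem f D⟩

end Pushforward

section Truncated

variable (k : Type u) [Field k] (n : ℕ)

/-- The truncated polynomial ring `k[ε] / (ε ^ (n + 1))`. -/
def Truncated : Type u := Polynomial k ⧸ Ideal.span {(Polynomial.X : Polynomial k) ^ (n + 1)}

instance : CommRing (Truncated k n) :=
  inferInstanceAs (CommRing (Polynomial k ⧸ Ideal.span {(Polynomial.X : Polynomial k) ^ (n + 1)}))

instance : Algebra k (Truncated k n) :=
  inferInstanceAs
    (Algebra k (Polynomial k ⧸ Ideal.span {(Polynomial.X : Polynomial k) ^ (n + 1)}))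

/-- The quotient map `k[X] → k[ε] / (ε ^ (n + 1))`. -/
def Truncated.mk : Polynomial k →ₐ[k] Truncated k n :=
  Ideal.Quotient.mkₐ k (Ideal.span {(Polynomial.X : Polynomial k) ^ (n + 1)})

theorem Truncated.mk_surjective : Function.Surjective (Truncated.mk k n) :=
  Ideal.Quotient.mkₐ_surjective k _

/-- The class `ε` of the variable in `k[ε] / (ε ^ (n + 1))`. -/
def eps : Truncated k n := Truncated.mk k n Polynomial.X

theorem eps_pow : eps k n ^ (n + 1) = 0 := by
  rw [eps, ← map_pow]
  exact Ideal.Quotient.eq_zero_iff_mem.2 (Ideal.mem_span_singleton_self _)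

theorem eps_pow_of_lt {m : ℕ} (hm : n < m) : eps k n ^ m = 0 :=
  pow_eq_zero_of_le hm (eps_pow k n)

instance : Nontrivial (Truncated k n) := by
  change Nontrivial (Polynomial k ⧸ Ideal.span {(Polynomial.X : Polynomial k) ^ (n + 1)})
  refine Ideal.Quotient.nontrivial_iff.2 fun h => ?_
  rw [Ideal.span_singleton_eq_top] at h
  exact Polynomial.not_isUnit_X (isUnit_of_dvd_unit (dvd_pow_self _ n.succ_ne_zero) h)

instance : IsLocalRing (Truncated k n) := by
  have key : ∀ (c : k) (q : Polynomial k), c ≠ 0 →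
      IsUnit (algebraMap k (Truncated k n) c + eps k n * Truncated.mk k n q) := by
    intro c q hc
    refine IsNilpotent.isUnit_add_left_of_commute ⟨n + 1, ?_⟩
      ((IsUnit.mk0 c hc).map (algebraMap k (Truncated k n))) (Commute.all _ _)
    rw [mul_pow, eps_pow, zero_mul]
  refine IsLocalRing.of_isUnit_or_isUnit_one_sub_self fun a => ?_
  obtain ⟨p, rfl⟩ := Truncated.mk_surjective k n a
  have hp : Truncated.mk k n p =
      algebraMap k (Truncated k n) (p.coeff 0) + eps k n * Truncated.mk k n p.divX := by
    conv_lhs => rw [← Polynomial.X_mul_divX_add p]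
    rw [map_add, map_mul, add_comm (Truncated.mk k n Polynomial.X * _)]
    rfl
  by_cases h0 : p.coeff 0 = 0
  · right
    have := key 1 (-p.divX) one_ne_zero
    rw [hp, h0, map_zero, zero_add]
    rwa [map_one, map_neg, mul_neg, ← sub_eq_add_neg] at this
  · left
    rw [hp]
    exact key _ _ h0

instance : IsArtinianRing (Truncated k n) :=
  haveI : Module.Finite k (Truncated k n) :=
    (Polynomial.monic_X_pow (n + 1)).finite_quotient
  IsArtinianRing.of_finite k _

variable {k n}

theorem residue_eps : IsLocalRing.residue (Truncated k n) (eps k n) = 0 := by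
  have h := congrArg (IsLocalRing.residue (Truncated k n)) (eps_pow k n)
  rw [map_pow, map_zero] at h
  exact eq_zero_of_pow_eq_zero h

variable {R : Type v} [CommRing R] [Algebra k R]

/-- The `k`-linear map `R → k[ε] / (ε ^ (n + 1)) ⊗ R`, `x ↦ ∑ i, ε ^ i ⊗ D i x`, of a
Hasse-Schmidt derivation of length `n`. -/
def Derivation.toLinear (D : Derivation k R n) : R →ₗ[k] Truncated k n ⊗[k] R :=
  ∑ i : Fin (n + 1), (TensorProduct.mk k (Truncated k n) R (eps k n ^ (i : ℕ))) ∘ₗ D.coeff i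

theorem Derivation.toLinear_apply (D : Derivation k R n) (x : R) :
    D.toLinear x = ∑ i : Fin (n + 1), (eps k n ^ (i : ℕ)) ⊗ₜ[k] D.coeff i x := by
  rw [Derivation.toLinear, LinearMap.sum_apply]
  rfl

theorem Derivation.toLinear_mul (D : Derivation k R n) (x y : R) :
    D.toLinear (x * y) = D.toLinear x * D.toLinear y := by
  classical
  simp only [Derivation.toLinear_apply]
  rw [Finset.sum_mul_sum, ← Finset.sum_product', Finset.univ_product_univ]
  simp only [Algebra.TensorProduct.tmul_mul_tmul, ← pow_add]
  have h1 : ∀ i : Fin (n + 1), (eps k n ^ (i : ℕ)) ⊗ₜ[k] D.coeff i (x * y) =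
      ∑ q : Fin (n + 1) × Fin (n + 1), if (q.1 : ℕ) + (q.2 : ℕ) = (i : ℕ) then
        (eps k n ^ ((q.1 : ℕ) + (q.2 : ℕ))) ⊗ₜ[k] (D.coeff q.1 x * D.coeff q.2 y) else 0 := by
    intro i
    rw [D.leibniz, TensorProduct.tmul_sum, Finset.sum_filter]
    refine Finset.sum_congr rfl fun q _ => ?_
    split_ifs with h
    · rw [h]
    · rfl
  rw [Finset.sum_congr rfl fun i _ => h1 i, Finset.sum_comm]
  refine Finset.sum_congr rfl fun q _ => ?_
  by_cases hq : (q.1 : ℕ) + (q.2 : ℕ) < n + 1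
  · rw [Finset.sum_eq_single (⟨(q.1 : ℕ) + (q.2 : ℕ), hq⟩ : Fin (n + 1))]
    · rw [if_pos rfl]
    · intro b _ hb
      refine if_neg fun h => hb (Fin.ext h.symm)
    · intro h
      exact absurd (Finset.mem_univ _) h
  · rw [eps_pow_of_lt k n (by omega), TensorProduct.zero_tmul]
    refine Finset.sum_eq_zero fun i _ => ?_
    split_ifs <;> rfl

theorem Derivation.reduction_toLinear (D : Derivation k R n) (x : R) :
    reduction k R (Truncated k n) (D.toLinear x) = 1 ⊗ₜ[k] x := by
  rw [Derivation.toLinear_apply, map_sum, Finset.sum_eq_single (0 : Fin (n + 1))]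
  · rw [reduction_tmul, D.coeff_zero, Fin.val_zero, pow_zero, map_one]
    rfl
  · intro i _ hi
    have hi' : (i : ℕ) ≠ 0 := fun h => hi (Fin.ext h)
    rw [reduction_tmul, map_pow, residue_eps, zero_pow hi', TensorProduct.zero_tmul]
  · intro h
    exact absurd (Finset.mem_univ _) h

theorem Derivation.coeff_one (D : Derivation k R n) (i : Fin (n + 1)) (hi : i ≠ 0) :
    D.coeff i 1 = 0 := by
  classical
  obtain ⟨m, hm⟩ := i
  induction m using Nat.strong_induction_on with
  | _ m ih =>
    set i : Fin (n + 1) := ⟨m, hm⟩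
    have hm0 : 0 < m := Nat.pos_of_ne_zero fun h => hi (Fin.ext h)
    have h := D.leibniz i 1 1
    rw [mul_one] at h
    have hz : D.coeff 0 1 = 1 := by rw [D.coeff_zero]; rfl
    rw [← Finset.sum_subset (s₁ := {((0 : Fin (n + 1)), i), (i, (0 : Fin (n + 1)))})] at h
    · rw [Finset.sum_pair (fun hc => hi (congrArg Prod.snd hc))] at h
      simp only [hz, one_mul, mul_one] at h
      exact left_eq_add.1 h
    · intro q hq
      rw [Finset.mem_insert, Finset.mem_singleton] at hq
      rw [Finset.mem_filter]
      rcases hq with rfl | rfl <;> simp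
    · rintro ⟨⟨a, ha⟩, ⟨b, hb⟩⟩ hq hq'
      have hab : a + b = m := (Finset.mem_filter.1 hq).2
      by_cases ha0 : a = 0
      · subst ha0
        have hbm : b = m := by omega
        subst hbm
        exact absurd (Finset.mem_insert_self _ _) hq'
      · by_cases ham : a = m
        · subst ham
          have hb0 : b = 0 := by omega
          subst hb0
          exact absurd (Finset.mem_insert_of_mem (Finset.mem_singleton_self _)) hq'
        · rw [ih a (by omega) ha (fun h => ha0 (congrArg Fin.val h)), zero_mul]

/-- The `k`-algebra homomorphism `R → k[ε] / (ε ^ (n + 1)) ⊗ R`,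
`x ↦ ∑ i, ε ^ i ⊗ D i x`, of a Hasse-Schmidt derivation of length `n`. -/
def Derivation.toAlgHom (D : Derivation k R n) : R →ₐ[k] Truncated k n ⊗[k] R :=
  AlgHom.ofLinearMap D.toLinear
    (by
      rw [Derivation.toLinear_apply, Finset.sum_eq_single (0 : Fin (n + 1))]
      · rw [D.coeff_zero, Fin.val_zero, pow_zero]
        rfl
      · intro i _ hi
        rw [D.coeff_one i hi, TensorProduct.tmul_zero]
      · intro h
        exact absurd (Finset.mem_univ _) h)
    D.toLinear_mul

/-- The deformation automorphism over `k[ε] / (ε ^ (n + 1))` that corresponds to a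
Hasse-Schmidt derivation `D` of length `n`: it sends `1 ⊗ x` to `∑ i, ε ^ i ⊗ D i x`. -/
def Derivation.toHS (D : Derivation k R n) : HS k R (Truncated k n) :=
  HS.ofAlgHom D.toAlgHom D.reduction_toLinear

end Truncated

section Bracket

variable {k : Type u} {R : Type v} {A : Type w} [Field k] [CommRing R] [Algebra k R]
  [CommRing A] [Algebra k A]

/-- `r(A, y)`: the largest natural number `r` with `y ^ r ≠ 0` (for `y` nilpotent). -/
def order (y : A) : ℕ := sSup {r : ℕ | y ^ r ≠ 0}

variable [IsLocalRing A] [IsArtinianRing A]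

theorem isNilpotent_of_mem (y : IsLocalRing.maximalIdeal A) : IsNilpotent (y : A) := by
  obtain ⟨j, hj⟩ := IsArtinianRing.isNilpotent_jacobson_bot (R := A)
  rw [IsLocalRing.jacobson_eq_maximalIdeal ⊥ bot_ne_top] at hj
  refine ⟨j, ?_⟩
  have := Ideal.pow_mem_pow y.2 j
  rw [hj] at this
  exact this

theorem pow_eq_zero_of_order_le (y : IsLocalRing.maximalIdeal A) {n : ℕ}
    (hn : order (y : A) ≤ n) : (y : A) ^ (n + 1) = 0 := by
  by_contra h
  obtain ⟨j, hj⟩ := isNilpotent_of_mem y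
  have hb : BddAbove {r : ℕ | (y : A) ^ r ≠ 0} :=
    ⟨j, fun r hr => le_of_not_gt fun hlt => hr (pow_eq_zero_of_le hlt.le hj)⟩
  have hle : n + 1 ≤ order (y : A) := le_csSup hb h
  omega

/-- The `k`-algebra homomorphism `k[ε] / (ε ^ (n + 1)) → A`, `ε ↦ y`, for `y ∈ 𝔪_A` and
`n ≥ r(A, y)`. -/
def evalHom (y : IsLocalRing.maximalIdeal A) {n : ℕ} (hn : order (y : A) ≤ n) :
    Truncated k n →ₐ[k] A :=
  Ideal.Quotient.liftₐ _ (Polynomial.aeval (y : A)) fun a ha => by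
    obtain ⟨b, rfl⟩ := Ideal.mem_span_singleton.1 ha
    rw [map_mul, map_pow, Polynomial.aeval_X, pow_eq_zero_of_order_le y hn, zero_mul]

theorem evalHom_eps (y : IsLocalRing.maximalIdeal A) {n : ℕ} (hn : order (y : A) ≤ n) :
    evalHom y hn (eps k n) = y :=
  Polynomial.aeval_X (R := k) (y : A)

instance (y : IsLocalRing.maximalIdeal A) {n : ℕ} (hn : order (y : A) ≤ n) :
    IsLocalHom (evalHom (k := k) y hn) where
  map_nonunit a ha := by
    by_contra hu
    obtain ⟨j, hj⟩ := isNilpotent_of_mem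
      (⟨a, (IsLocalRing.mem_maximalIdeal a).2 hu⟩ : IsLocalRing.maximalIdeal (Truncated k n))
    have h0 : evalHom (k := k) y hn a ^ j = 0 := by
      rw [← map_pow]
      exact (congrArg _ hj).trans (map_zero _)
    exact not_isUnit_zero (h0 ▸ ha.pow j)

/-- `D⟨y⟩ ∈ HS^A(R)`, for a Hasse-Schmidt derivation `D` of length `n ≥ r(A, y)`: the
pushforward of `D` along `k[ε] / (ε ^ (n + 1)) → A`, `ε ↦ y`. -/
def bracket (y : IsLocalRing.maximalIdeal A) {n : ℕ} (hn : order (y : A) ≤ n)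
    (D : Derivation k R n) : HS k R A :=
  pushforward (evalHom y hn) D.toHS

end Bracket

end HasseSchmidt

end

/-! Call pushforwards of Hasse–Schmidt derivations of finite length curves, and write `E⟨y⟩` for the
curve with parameter `y`. The proof is an induction along small extensions `π : A → A'`, whose
kernel is a line `k t` killed by `𝔪_A`. Assume that curves generate `HS^{A'}(R)`, and let `K` be the
image in `HS^{A'}(R)` of the group generated by curves over `A`.

Factorization. Over a monomial quotient of `k[x, y]`, an automorphism that is trivial modulo `x` and
modulo `y` is a product of curves along monomials `x^i y^j` with `i, j > 0`: its components of
minimal slope form a Hasse–Schmidt derivation, which can be split off (`exists_peel`), and the slope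
rises until nothing is left. This applies to commutators of `E⟨x⟩` and `F⟨y⟩` and to the additivity
defect `E⟨x+y⟩ E⟨x⟩⁻¹ E⟨y⟩⁻¹`. When elements of `𝔪_A` are substituted for `x` and `y`, such interior
curves lift to `A` (`map_interior_mem`): where a power of `x^i y^j` vanishes in the box, one factor
lies in `k t` and the other in `𝔪_A`. Hence `K` is normal, and a curve of length `p^a - 1` over `A'`
depends modulo `K` only on the `p^a`-th power, taken in `A`, of a lift of its parameter.

Obstruction. Write `R` as a polynomial ring `P` modulo relations `J` and lift `D ∈ HS^{A'}(R)` to an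
automorphism of `A ⊗ P`; on `J` it induces a map `J → t ⊗ R`. This map is additive in `D`, natural
in the extension and unique up to restrictions of derivations `P → R`; `D` lifts to `A` if and only
if it can be made zero. Computing the obstruction of an additivity defect in two ways shows that
every obstruction to extending a derivation of length `n` already occurs in length `p^a - 1`, where
`p^a` is the exact power of `p` dividing `n + 1` (`obsGroup_le_of_prime_pow`).

Conclusion (`curveGroup_eq_top_of_isSmall`). Let `y` lift the parameter of a curve `E⟨π y⟩` of
length `n`. If `y^(n+1) = 0`, the curve lies in `K`; otherwise scaling gives `y^(n+1) = t`. Modulo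
`K` the length may be replaced by `p^a - 1`, and then the parameter by a power of one fixed root
`y₀` of `t` of maximal `p`-power order `p^b`. So `HS^{A'}(R)` is `K` times the group of curves along
`π y₀`. For `D ∈ HS^A(R)` write its image as `x E⟨π y₀⟩` with `x ∈ K`. Then `E⟨π y₀⟩` lifts to `A`,
so its obstruction, which is that of `E`, vanishes; thus `E` extends to length `p^b` and yields a
curve over `A` above `E⟨π y₀⟩`. The rest of `D` is killed by `π`, so it is `1 + t δ` with a
derivation `δ`, a curve along `t`. -/

open scoped TensorProduct

noncomputable section

set_option linter.unusedSectionVars false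

namespace HasseSchmidt

universe u v w w' w''

/-! ### Functoriality of `HS^A(R)` in `A` -/

section Functoriality

variable {k : Type u} {R : Type v} {A : Type w} {B : Type w'} {C : Type w''}
  [Field k] [CommRing R] [Algebra k R]
  [CommRing A] [Algebra k A] [CommRing B] [Algebra k B] [CommRing C] [Algebra k C]

variable (R) in
/-- The map `f ⊗ id_R`. -/
abbrev tensorMap (f : A →ₐ[k] B) : A ⊗[k] R →ₐ[k] B ⊗[k] R :=
  Algebra.TensorProduct.map f (AlgHom.id k R)

theorem tensorMap_smul (f : A →ₐ[k] B) (a : A) (z : A ⊗[k] R) :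
    tensorMap R f (a • z) = f a • tensorMap R f z := by
  rw [Algebra.smul_def, Algebra.smul_def, map_mul]
  congr 1

variable [IsLocalRing A] [IsArtinianRing A] [IsLocalRing B] [IsArtinianRing B]
  [IsLocalRing C] [IsArtinianRing C]

instance isLocalHom_of_isArtinianRing (f : A →ₐ[k] B) : IsLocalHom f where
  map_nonunit a ha := by
    by_contra hu
    obtain ⟨j, hj⟩ := isNilpotent_of_mem
      (⟨a, (IsLocalRing.mem_maximalIdeal a).2 hu⟩ : IsLocalRing.maximalIdeal A)
    have h0 : f a ^ j = 0 := by
      rw [← map_pow]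
      exact (congrArg _ hj).trans (map_zero _)
    exact not_isUnit_zero (h0 ▸ ha.pow j)

theorem HS.ext {D E : HS k R A} (h : ∀ r : R, D.1 (1 ⊗ₜ[k] r) = E.1 (1 ⊗ₜ[k] r)) : D = E := by
  refine Subtype.ext (AlgEquiv.ext fun z => ?_)
  induction z using TensorProduct.induction_on with
  | zero => rw [map_zero, map_zero]
  | tmul a r =>
    have : a ⊗ₜ[k] r = a • ((1 : A) ⊗ₜ[k] r) := by
      rw [TensorProduct.smul_tmul', smul_eq_mul, mul_one]
    rw [this, map_smul, map_smul, h]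
  | add x y hx hy => rw [map_add, map_add, hx, hy]

theorem pushforward_apply_tensorMap (f : A →ₐ[k] B) (D : HS k R A) (z : A ⊗[k] R) :
    (pushforward f D).1 (tensorMap R f z) = tensorMap R f (D.1 z) := by
  induction z using TensorProduct.induction_on with
  | zero => simp only [map_zero]
  | tmul a r =>
    have : a ⊗ₜ[k] r = a • ((1 : A) ⊗ₜ[k] r) := by
      rw [TensorProduct.smul_tmul', smul_eq_mul, mul_one]
    have h2 : D.1 (a ⊗ₜ[k] r) = a • D.1 (1 ⊗ₜ[k] r) := by rw [this, map_smul]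
    rw [h2, tensorMap_smul, Algebra.TensorProduct.map_tmul]
    exact baseChange_tmul f D.1 (f a) r
  | add x y hx hy => simp only [map_add, hx, hy]

theorem pushforward_one_tmul (f : A →ₐ[k] B) (D : HS k R A) (r : R) :
    (pushforward f D).1 (1 ⊗ₜ[k] r) = tensorMap R f (D.1 (1 ⊗ₜ[k] r)) := by
  rw [← pushforward_apply_tensorMap, Algebra.TensorProduct.map_tmul, map_one]
  rfl

/-- Pushforward along `f : A → B` as a group homomorphism `HS^A(R) → HS^B(R)`. -/
def HS.map (f : A →ₐ[k] B) : HS k R A →* HS k R B :=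
  MonoidHom.mk' (pushforward f) fun D E => HS.ext fun r => by
    rw [pushforward_one_tmul]
    change _ = (pushforward f D).1 ((pushforward f E).1 (1 ⊗ₜ[k] r))
    rw [pushforward_one_tmul f E, pushforward_apply_tensorMap]
    rfl

theorem HS.map_apply_tensorMap (f : A →ₐ[k] B) (D : HS k R A) (z : A ⊗[k] R) :
    (HS.map f D).1 (tensorMap R f z) = tensorMap R f (D.1 z) :=
  pushforward_apply_tensorMap f D z

theorem HS.map_one_tmul (f : A →ₐ[k] B) (D : HS k R A) (r : R) :
    (HS.map f D).1 (1 ⊗ₜ[k] r) = tensorMap R f (D.1 (1 ⊗ₜ[k] r)) :=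
  pushforward_one_tmul f D r

theorem HS.map_map (g : B →ₐ[k] C) (f : A →ₐ[k] B) (D : HS k R A) :
    HS.map g (HS.map f D) = HS.map (g.comp f) D := HS.ext fun r => by
  rw [HS.map_one_tmul, HS.map_one_tmul, HS.map_one_tmul, ← AlgHom.comp_apply,
    ← Algebra.TensorProduct.map_comp]
  rfl

/-! ### Augmentations -/

variable (R) in
/-- The reduction map `A ⊗ R → R` of an augmentation `e : A → k`. -/
def augment (e : A →ₐ[k] k) : A ⊗[k] R →ₐ[k] R :=
  (Algebra.TensorProduct.lid k R).toAlgHom.comp (tensorMap R e)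

@[simp]
theorem augment_tmul (e : A →ₐ[k] k) (a : A) (r : R) : augment R e (a ⊗ₜ[k] r) = e a • r := by
  simp [augment]

theorem augment_smul (e : A →ₐ[k] k) (a : A) (z : A ⊗[k] R) :
    augment R e (a • z) = e a • augment R e z := by
  induction z using TensorProduct.induction_on with
  | zero => simp only [smul_zero, map_zero]
  | tmul b r => rw [TensorProduct.smul_tmul', augment_tmul, augment_tmul, smul_eq_mul, map_mul,
      mul_smul]
  | add x y hx hy => simp only [smul_add, map_add, hx, hy]

theorem aug_eq_zero (e : A →ₐ[k] k) {a : A} (ha : a ∈ IsLocalRing.maximalIdeal A) : e a = 0 :=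
  (isNilpotent_of_mem ⟨a, ha⟩).map e |>.eq_zero

theorem mem_maximalIdeal_of_aug (e : A →ₐ[k] k) {a : A} (ha : e a = 0) :
    a ∈ IsLocalRing.maximalIdeal A :=
  (IsLocalRing.mem_maximalIdeal a).2 fun hu => (ha ▸ hu.map e).ne_zero rfl

/-- An augmentation must kill the nilpotent maximal ideal, a complement of `k`, so there is at most
one. Augmentations are therefore compatible with every homomorphism. -/
theorem aug_comp (e : A →ₐ[k] k) (e' : B →ₐ[k] k) (f : A →ₐ[k] B) : e'.comp f = e := by
  ext a
  have h : e (a - algebraMap k A (e a)) = 0 := by simp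
  have h2 : (e'.comp f) (a - algebraMap k A (e a)) = 0 :=
    aug_eq_zero _ (mem_maximalIdeal_of_aug e h)
  rw [map_sub, AlgHom.commutes, sub_eq_zero] at h2
  exact h2

theorem HS.augment_apply (e : A →ₐ[k] k) (D : HS k R A) (z : A ⊗[k] R) :
    augment R e (D.1 z) = augment R e z := by
  have h := sub_mem_of_reduction_eq (D.2 z)
  rw [← sub_eq_zero, ← map_sub]
  refine Submodule.smul_induction_on h (fun a ha z _ => ?_) fun x y hx hy => ?_
  · rw [augment_smul, aug_eq_zero e ha, zero_smul]
  · rw [map_add, hx, hy, add_zero]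

theorem reduction_eq_augment (e : A →ₐ[k] k) (z : A ⊗[k] R) :
    reduction k R A z = 1 ⊗ₜ[k] augment R e z := by
  induction z using TensorProduct.induction_on with
  | zero => simp only [map_zero, TensorProduct.tmul_zero]
  | tmul a r =>
    have : IsLocalRing.residue A a = algebraMap k (IsLocalRing.ResidueField A) (e a) := by
      rw [← sub_eq_zero]
      have := (IsLocalRing.residue_eq_zero_iff (a - algebraMap k A (e a))).2
        (mem_maximalIdeal_of_aug e (by simp))
      rw [map_sub] at this
      exact this
    rw [reduction_tmul, augment_tmul, this, ← TensorProduct.smul_tmul, Algebra.smul_def, mul_one]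
  | add x y hx hy => simp only [map_add, hx, hy, TensorProduct.tmul_add]

/-- The element of `HS^A(R)` given by an algebra homomorphism `R → A ⊗ R` that lifts `id_R`. -/
def HS.lift (e : A →ₐ[k] k) (f : R →ₐ[k] A ⊗[k] R) (hf : ∀ r, augment R e (f r) = r) :
    HS k R A :=
  HS.ofAlgHom f fun r => by rw [reduction_eq_augment e, hf]

theorem HS.lift_one_tmul (e : A →ₐ[k] k) (f : R →ₐ[k] A ⊗[k] R)
    (hf : ∀ r, augment R e (f r) = r) (r : R) : (HS.lift e f hf).1 (1 ⊗ₜ[k] r) = f r := by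
  change extend f (1 ⊗ₜ[k] r) = f r
  rw [extend_tmul, one_smul]

/-- The pushforward passes through `HS^k(R)`, which is trivial. -/
theorem HS.map_eq_one_of_factor (e : A →ₐ[k] k) (f : A →ₐ[k] B)
    (h : f = (Algebra.ofId k B).comp e) (D : HS k R A) : HS.map f D = 1 := HS.ext fun r => by
  have key : ∀ z : A ⊗[k] R, tensorMap R f z = 1 ⊗ₜ[k] augment R e z := by
    intro z
    induction z using TensorProduct.induction_on with
    | zero => simp only [map_zero, TensorProduct.tmul_zero]
    | tmul a r =>
      rw [Algebra.TensorProduct.map_tmul, h, augment_tmul, ← TensorProduct.smul_tmul,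
        Algebra.smul_def, mul_one]
      rfl
    | add x y hx hy => simp only [map_add, hx, hy, TensorProduct.tmul_add]
  rw [HS.map_one_tmul, key, HS.augment_apply, augment_tmul, map_one, one_smul]
  rfl

end Functoriality

/-! ### Truncated polynomial rings and their homomorphisms -/

section Truncated

variable {k : Type u} [Field k] {A : Type w} [CommRing A] [Algebra k A] {n : ℕ}

/-- The homomorphism `k[ε] / (ε ^ (n + 1)) → A`, `ε ↦ y`, for `y ^ (n + 1) = 0`. -/
def Truncated.lift (y : A) (hy : y ^ (n + 1) = 0) : Truncated k n →ₐ[k] A :=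
  Ideal.Quotient.liftₐ _ (Polynomial.aeval y) fun a ha => by
    obtain ⟨b, rfl⟩ := Ideal.mem_span_singleton.1 ha
    rw [map_mul, map_pow, Polynomial.aeval_X, hy, zero_mul]

@[simp]
theorem Truncated.lift_eps (y : A) (hy : y ^ (n + 1) = 0) :
    Truncated.lift y hy (eps k n) = y :=
  Polynomial.aeval_X (R := k) y

theorem Truncated.hom_ext {f g : Truncated k n →ₐ[k] A} (h : f (eps k n) = g (eps k n)) :
    f = g := by
  have : f.comp (Truncated.mk k n) = g.comp (Truncated.mk k n) := Polynomial.algHom_ext h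
  ext a
  obtain ⟨p, rfl⟩ := Truncated.mk_surjective k n a
  exact DFunLike.congr_fun this p

theorem Truncated.eps_map_pow (f : Truncated k n →ₐ[k] A) : f (eps k n) ^ (n + 1) = 0 := by
  rw [← map_pow, eps_pow, map_zero]

variable (k n) in
/-- The augmentation of `k[ε] / (ε ^ (n + 1))`. -/
def Truncated.aug : Truncated k n →ₐ[k] k := Truncated.lift 0 (zero_pow n.succ_ne_zero)

variable (k n) in
/-- The truncation map `k[ε] / (ε ^ (n + 2)) → k[ε] / (ε ^ (n + 1))`. -/
def Truncated.trunc : Truncated k (n + 1) →ₐ[k] Truncated k n :=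
  Truncated.lift (eps k n) (eps_pow_of_lt k n (by omega))

@[simp]
theorem Truncated.trunc_eps : Truncated.trunc k n (eps k (n + 1)) = eps k n :=
  Truncated.lift_eps _ _

theorem HS.map_eq_one_of_eps {R : Type v} [CommRing R] [Algebra k R] [IsLocalRing A]
    [IsArtinianRing A] (f : Truncated k n →ₐ[k] A) (h : f (eps k n) = 0)
    (D : HS k R (Truncated k n)) : HS.map f D = 1 :=
  HS.map_eq_one_of_factor (Truncated.aug k n) f (Truncated.hom_ext (by
    rw [h, AlgHom.comp_apply, Truncated.aug, Truncated.lift_eps, map_zero])) D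

end Truncated

/-! ### Algebras with a finite basis of monomials -/

/-- A finite basis of the `k`-algebra `A` made of monomials `mon m`, `m ∈ supp`; the monomials
outside `supp` vanish. -/
structure MonomialBasis (k : Type u) (A : Type w) (M : Type*) [Field k] [CommRing A] [Algebra k A]
    [AddCommMonoid M] [DecidableEq M] where
  /-- the monomials -/
  mon : M → A
  mon_zero : mon 0 = 1
  mon_add : ∀ m n, mon (m + n) = mon m * mon n
  /-- the exponents of the nonzero monomials -/
  supp : Finset M
  mon_eq_zero : ∀ m, m ∉ supp → mon m = 0
  /-- the coefficient functionals -/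
  coeff : M → A →ₗ[k] k
  coeff_mon : ∀ m ∈ supp, ∀ n, coeff m (mon n) = if n = m then 1 else 0
  expand : ∀ a, a = ∑ m ∈ supp, coeff m a • mon m
  /-- the augmentation -/
  aug : A →ₐ[k] k
  aug_mon : ∀ m, m ≠ 0 → aug (mon m) = 0

namespace MonomialBasis

variable {k : Type u} {R : Type v} {A : Type w} {M : Type*} [Field k] [CommRing R] [Algebra k R]
  [CommRing A] [Algebra k A] [AddCommMonoid M] [DecidableEq M] (B : MonomialBasis k A M)

theorem zero_mem [Nontrivial A] : (0 : M) ∈ B.supp := by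
  by_contra h
  exact one_ne_zero (B.mon_zero.symm.trans (B.mon_eq_zero 0 h))

theorem mon_nsmul (m : M) (i : ℕ) : B.mon (i • m) = B.mon m ^ i := by
  induction i with
  | zero => rw [zero_smul, pow_zero, B.mon_zero]
  | succ i ih => rw [succ_nsmul, B.mon_add, ih, pow_succ]

theorem mem_of_mon_ne_zero {m : M} (h : B.mon m ≠ 0) : m ∈ B.supp := by
  by_contra hm
  exact h (B.mon_eq_zero m hm)

theorem mon_ne_zero {m : M} (h : m ∈ B.supp) : B.mon m ≠ 0 := fun h0 => by
  have := B.coeff_mon m h m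
  rw [h0, map_zero, if_pos rfl] at this
  exact zero_ne_one this

theorem aug_eq_coeff_zero [Nontrivial A] (a : A) : B.aug a = B.coeff 0 a := by
  conv_lhs => rw [B.expand a]
  rw [map_sum, Finset.sum_eq_single 0]
  · rw [map_smul, B.mon_zero, map_one, smul_eq_mul, mul_one]
  · intro m _ hm
    rw [map_smul, B.aug_mon m hm, smul_zero]
  · exact fun h => absurd B.zero_mem h

variable (R) in
/-- The coefficient map `A ⊗ R → R`. -/
def coeffMap (m : M) : A ⊗[k] R →ₗ[k] R :=
  (TensorProduct.lid k R).toLinearMap ∘ₗ (B.coeff m).rTensor R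

@[simp]
theorem coeffMap_tmul (m : M) (a : A) (r : R) : B.coeffMap R m (a ⊗ₜ[k] r) = B.coeff m a • r := by
  simp [coeffMap]

theorem expand_tensor (z : A ⊗[k] R) : z = ∑ m ∈ B.supp, B.mon m ⊗ₜ[k] B.coeffMap R m z := by
  induction z using TensorProduct.induction_on with
  | zero => simp
  | tmul a r =>
    conv_lhs => rw [B.expand a, TensorProduct.sum_tmul]
    refine Finset.sum_congr rfl fun m _ => ?_
    rw [coeffMap_tmul, TensorProduct.smul_tmul]
  | add x y hx hy =>
    simp only [map_add, TensorProduct.tmul_add, Finset.sum_add_distrib]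
    rw [← hx, ← hy]

theorem coeffMap_mul {m : M} (hm : m ∈ B.supp) (z z' : A ⊗[k] R) :
    B.coeffMap R m (z * z') = ∑ q ∈ B.supp ×ˢ B.supp with q.1 + q.2 = m,
      B.coeffMap R q.1 z * B.coeffMap R q.2 z' := by
  conv_lhs => rw [B.expand_tensor z, B.expand_tensor z']
  rw [Finset.sum_mul_sum, ← Finset.sum_product', map_sum, Finset.sum_filter]
  refine Finset.sum_congr rfl fun q _ => ?_
  rw [Algebra.TensorProduct.tmul_mul_tmul, ← B.mon_add, coeffMap_tmul, B.coeff_mon m hm]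
  split_ifs
  · rw [one_smul]
  · rw [zero_smul]

variable [IsLocalRing A] [IsArtinianRing A]

/-- The components of an element of `HS^A(R)` with respect to a basis of monomials. -/
def comp (m : M) (D : HS k R A) : R →ₗ[k] R :=
  B.coeffMap R m ∘ₗ D.1.toLinearMap.restrictScalars k ∘ₗ TensorProduct.mk k A R 1

theorem comp_apply (m : M) (D : HS k R A) (r : R) :
    B.comp m D r = B.coeffMap R m (D.1 (1 ⊗ₜ[k] r)) := rfl

theorem apply_one_tmul (D : HS k R A) (r : R) :
    D.1 (1 ⊗ₜ[k] r) = ∑ m ∈ B.supp, B.mon m ⊗ₜ[k] B.comp m D r :=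
  B.expand_tensor _

theorem comp_zero (D : HS k R A) : B.comp 0 D = LinearMap.id := by
  ext r
  have : ∀ z : A ⊗[k] R, B.coeffMap R 0 z = augment R B.aug z := by
    intro z
    induction z using TensorProduct.induction_on with
    | zero => simp only [map_zero]
    | tmul a r => rw [coeffMap_tmul, augment_tmul, B.aug_eq_coeff_zero]
    | add x y hx hy => rw [map_add, map_add, hx, hy]
  rw [comp_apply, this, HS.augment_apply, augment_tmul, map_one, one_smul]
  rfl

theorem comp_leibniz {m : M} (hm : m ∈ B.supp) (D : HS k R A) (x y : R) :
    B.comp m D (x * y) = ∑ q ∈ B.supp ×ˢ B.supp with q.1 + q.2 = m,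
      B.comp q.1 D x * B.comp q.2 D y := by
  simp only [comp_apply]
  rw [← B.coeffMap_mul hm, ← map_mul, Algebra.TensorProduct.tmul_mul_tmul, one_mul]

/-- By `A`-linearity of `D`, composition turns into convolution of components. This makes
degree-by-degree comparison of factorizations possible. -/
theorem comp_mul {m : M} (hm : m ∈ B.supp) (D E : HS k R A) (r : R) :
    B.comp m (D * E) r = ∑ q ∈ B.supp ×ˢ B.supp with q.1 + q.2 = m,
      B.comp q.1 D (B.comp q.2 E r) := by
  have h : (D * E).1 (1 ⊗ₜ[k] r) = ∑ l ∈ B.supp, ∑ n ∈ B.supp,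
      B.mon (l + n) ⊗ₜ[k] B.comp l D (B.comp n E r) := by
    change D.1 (E.1 (1 ⊗ₜ[k] r)) = _
    rw [B.apply_one_tmul E, map_sum, Finset.sum_comm]
    refine Finset.sum_congr rfl fun n _ => ?_
    have : B.mon n ⊗ₜ[k] B.comp n E r = B.mon n • ((1 : A) ⊗ₜ[k] B.comp n E r) := by
      rw [TensorProduct.smul_tmul', smul_eq_mul, mul_one]
    rw [this, map_smul, B.apply_one_tmul D, Finset.smul_sum]
    refine Finset.sum_congr rfl fun l _ => ?_
    rw [TensorProduct.smul_tmul', smul_eq_mul, B.mon_add, mul_comm]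
  rw [comp_apply, h, ← Finset.sum_product', map_sum, Finset.sum_filter]
  refine Finset.sum_congr rfl fun q _ => ?_
  rw [coeffMap_tmul, B.coeff_mon m hm]
  split_ifs
  · rw [one_smul]
  · rw [zero_smul]

theorem eq_one_of_comp {D : HS k R A} (h : ∀ m ∈ B.supp, m ≠ 0 → B.comp m D = 0) : D = 1 :=
  HS.ext fun r => by
    rw [B.apply_one_tmul, Finset.sum_eq_single 0]
    · rw [B.mon_zero, B.comp_zero]
      rfl
    · intro m hm hm0
      rw [h m hm hm0, LinearMap.zero_apply, TensorProduct.tmul_zero]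
    · exact fun h0 => absurd B.zero_mem h0

/-- If an endomorphism `ρ` of `A` fixes the monomials in a set and kills all other monomials,
then an element of `HS^A(R)` killed by `ρ` has no components in this set. -/
theorem comp_eq_zero_of_map {ρ : A →ₐ[k] A} {P : M → Prop} (hρ : ∀ m, P m → ρ (B.mon m) = B.mon m)
    (hρ' : ∀ m, ¬ P m → ρ (B.mon m) = 0) {D : HS k R A} (hD : HS.map ρ D = 1) {m : M}
    (hm : m ∈ B.supp) (hPm : P m) (hm0 : m ≠ 0) : B.comp m D = 0 := by
  ext r
  have h1 : ∀ z : A ⊗[k] R, B.coeffMap R m (tensorMap R ρ z) = B.coeffMap R m z := by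
    intro z
    rw [B.expand_tensor z, map_sum, map_sum, map_sum]
    refine Finset.sum_congr rfl fun n _ => ?_
    rw [Algebra.TensorProduct.map_tmul, coeffMap_tmul, coeffMap_tmul]
    by_cases hn : P n
    · rw [hρ n hn]
      rfl
    · rw [hρ' n hn, map_zero, B.coeff_mon m hm, if_neg (by rintro rfl; exact hn hPm), zero_smul,
        zero_smul]
  rw [comp_apply, ← h1, ← HS.map_one_tmul, hD]
  change B.coeffMap R m (1 ⊗ₜ[k] r) = 0
  rw [coeffMap_tmul, ← B.mon_zero, B.coeff_mon m hm, if_neg hm0.symm, zero_smul]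

end MonomialBasis

/-! ### Hasse–Schmidt derivations as automorphisms over truncated polynomial rings -/

section TruncatedBasis

variable {k : Type u} [Field k] {n : ℕ}

/-- The coefficient of `ε ^ i` in `k[ε] / (ε ^ (n + 1))`. -/
def Truncated.coeff (i : ℕ) (hi : i < n + 1) : Truncated k n →ₗ[k] k :=
  Submodule.liftQ ((Ideal.span {(Polynomial.X : Polynomial k) ^ (n + 1)}).restrictScalars k)
    (Polynomial.lcoeff k i) fun a ha => by
      obtain ⟨b, rfl⟩ := Ideal.mem_span_singleton.1 ((Submodule.restrictScalars_mem k _ _).1 ha)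
      rw [LinearMap.mem_ker, Polynomial.lcoeff_apply, Polynomial.coeff_X_pow_mul',
        if_neg (Nat.not_le.2 hi)]

theorem Truncated.coeff_mk (i : ℕ) (hi : i < n + 1) (p : Polynomial k) :
    Truncated.coeff i hi (Truncated.mk k n p) = p.coeff i := rfl

variable (k n) in
/-- The monomial basis of `k[ε] / (ε ^ (n + 1))`. -/
def Truncated.basis : MonomialBasis k (Truncated k n) ℕ where
  mon i := eps k n ^ i
  mon_zero := pow_zero _
  mon_add := pow_add _
  supp := Finset.range (n + 1)
  mon_eq_zero m hm := eps_pow_of_lt k n (by simpa using hm)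
  coeff i := if h : i < n + 1 then Truncated.coeff i h else 0
  coeff_mon m hm i := by
    rw [dif_pos (by simpa using hm)]
    have : eps k n ^ i = Truncated.mk k n (Polynomial.X ^ i) := by rw [map_pow]; rfl
    rw [this, Truncated.coeff_mk, Polynomial.coeff_X_pow]
    exact if_congr eq_comm rfl rfl
  expand a := by
    obtain ⟨p, rfl⟩ := Truncated.mk_surjective k n a
    -- The range is long enough for both the degree of `p` and the basis; the powers of `ε` beyond
    -- `n` are dropped afterwards.
    have h1 : Truncated.mk k n p = ∑ i ∈ Finset.range (p.natDegree + 1 + (n + 1)),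
        p.coeff i • eps k n ^ i := by
      conv_lhs => rw [p.as_sum_range' (p.natDegree + 1 + (n + 1)) (by omega), map_sum]
      refine Finset.sum_congr rfl fun i _ => ?_
      rw [← Polynomial.smul_X_eq_monomial, map_smul, map_pow]
      rfl
    rw [h1, ← h1]
    conv_lhs => rw [h1]
    rw [← Finset.sum_subset (Finset.range_mono (by omega : n + 1 ≤ p.natDegree + 1 + (n + 1)))]
    · refine Finset.sum_congr rfl fun i hi => ?_
      rw [dif_pos (by simpa using hi), Truncated.coeff_mk]
    · intro i _ hi
      rw [eps_pow_of_lt k n (by simpa using hi), smul_zero]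
  aug := Truncated.aug k n
  aug_mon i hi := by rw [map_pow, Truncated.aug, Truncated.lift_eps, zero_pow hi]

variable {R : Type v} [CommRing R] [Algebra k R]

theorem Derivation.toHS_one_tmul (E : Derivation k R n) (r : R) :
    E.toHS.1 (1 ⊗ₜ[k] r) = ∑ i : Fin (n + 1), (eps k n ^ (i : ℕ)) ⊗ₜ[k] E.coeff i r := by
  rw [← Derivation.toLinear_apply]
  change extend E.toAlgHom (1 ⊗ₜ[k] r) = _
  rw [extend_tmul, one_smul]
  rfl

/-- The components with respect to the powers of `ε` satisfy the Leibniz rule. Hence the group `HS`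
over the truncated ring can stand in for sequences of maps, and inverses of curves are again curves.
-/
theorem Derivation.toHS_surjective :
    Function.Surjective (Derivation.toHS : Derivation k R n → HS k R (Truncated k n)) := by
  intro D
  let B := Truncated.basis k n
  have hB : B.supp = Finset.range (n + 1) := rfl
  refine ⟨⟨fun i => B.comp i D, B.comp_zero D, fun i x y => ?_⟩, HS.ext fun r => ?_⟩
  · rw [B.comp_leibniz (by rw [hB]; exact Finset.mem_range.2 i.2)]
    symm
    refine Finset.sum_of_injOn (fun q => ((q.1 : ℕ), (q.2 : ℕ))) ?_ ?_ ?_ ?_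
    · intro a _ b _ hab
      simp only [Prod.mk.injEq] at hab
      exact Prod.ext (Fin.ext hab.1) (Fin.ext hab.2)
    · intro q hq
      simp only [hB, Finset.coe_filter, Finset.mem_univ, true_and, Set.mem_ofPred_eq,
        Finset.mem_product, Finset.mem_range] at hq ⊢
      exact ⟨⟨q.1.2, q.2.2⟩, hq⟩
    · intro q hq hq'
      simp only [hB, Finset.mem_filter, Finset.mem_product, Finset.mem_range] at hq
      refine absurd ⟨(⟨q.1, hq.1.1⟩, ⟨q.2, hq.1.2⟩), ?_, rfl⟩ hq'
      simpa using hq.2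
    · intro q _
      rfl
  · rw [Derivation.toHS_one_tmul, B.apply_one_tmul]
    exact (Finset.sum_range fun i => B.mon i ⊗ₜ[k] B.comp i D r).symm

end TruncatedBasis

/-! ### Monomial quotients of the polynomial ring in two variables -/

/-- A finite staircase: a nonempty finite set of exponents closed under divisors. -/
structure Staircase where
  /-- the underlying finite set -/
  carrier : Finset (ℕ × ℕ)
  zero_mem : (0 : ℕ × ℕ) ∈ carrier
  lower : ∀ m n, m + n ∈ carrier → m ∈ carrier

/-- The ideal of `k[x, y]` spanned by the monomials outside a staircase. -/
def Staircase.ideal (k : Type u) [Field k] (S : Staircase) :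
    Ideal (AddMonoidAlgebra k (ℕ × ℕ)) where
  carrier := {f | ∀ m ∈ S.carrier, f.coeff m = 0}
  zero_mem' := fun _ _ => rfl
  add_mem' := fun {f g} hf hg m hm => by
    rw [AddMonoidAlgebra.coeff_add, Finsupp.add_apply, hf m hm, hg m hm, add_zero]
  smul_mem' := fun c f hf m hm => by
    classical
    rw [smul_eq_mul, AddMonoidAlgebra.coeff_mul]
    refine Finset.sum_eq_zero fun a _ => Finset.sum_eq_zero fun b _ => ?_
    dsimp only
    split_ifs with h
    · rw [hf b (S.lower b a (by rwa [add_comm, h])), mul_zero]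
    · rfl

/-- The quotient of `k[x, y]` by the monomials outside a staircase. -/
def MonomialAlgebra (k : Type u) [Field k] (S : Staircase) : Type u :=
  AddMonoidAlgebra k (ℕ × ℕ) ⧸ S.ideal k

namespace MonomialAlgebra

variable {k : Type u} [Field k] {S : Staircase}

instance : CommRing (MonomialAlgebra k S) :=
  inferInstanceAs (CommRing (AddMonoidAlgebra k (ℕ × ℕ) ⧸ S.ideal k))

instance : Algebra k (MonomialAlgebra k S) :=
  inferInstanceAs (Algebra k (AddMonoidAlgebra k (ℕ × ℕ) ⧸ S.ideal k))

variable (k S) in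
/-- The quotient map. -/
def mk : AddMonoidAlgebra k (ℕ × ℕ) →ₐ[k] MonomialAlgebra k S :=
  Ideal.Quotient.mkₐ k (S.ideal k)

theorem mk_surjective : Function.Surjective (mk k S) := Ideal.Quotient.mkₐ_surjective k _

variable (k S) in
/-- The class of a monomial. -/
def mon (m : ℕ × ℕ) : MonomialAlgebra k S := mk k S (AddMonoidAlgebra.single m 1)

theorem mon_eq_zero {m : ℕ × ℕ} (hm : m ∉ S.carrier) : mon k S m = 0 :=
  Ideal.Quotient.eq_zero_iff_mem.2 fun n hn => by
    rw [AddMonoidAlgebra.coeff_single, Finsupp.single_apply, if_neg]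
    rintro rfl
    exact hm hn

theorem mon_zero : mon k S 0 = 1 := map_one (mk k S)

theorem mon_add (m n : ℕ × ℕ) : mon k S (m + n) = mon k S m * mon k S n := by
  rw [mon, mon, mon, ← map_mul, AddMonoidAlgebra.single_mul_single, mul_one]

variable {A : Type w} [CommRing A] [Algebra k A]

/-- The homomorphism `x ↦ y`, `y ↦ z` out of a monomial algebra. -/
def lift (y z : A) (h : ∀ m, m ∉ S.carrier → y ^ m.1 * z ^ m.2 = 0) :
    MonomialAlgebra k S →ₐ[k] A :=
  Ideal.Quotient.liftₐ _ (AddMonoidAlgebra.lift k A (ℕ × ℕ)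
    { toFun := fun m => y ^ m.toAdd.1 * z ^ m.toAdd.2
      map_one' := by simp
      map_mul' := fun m n => by
        rw [toAdd_mul, Prod.fst_add, Prod.snd_add, pow_add, pow_add]
        ring }) fun f hf => by
    rw [AddMonoidAlgebra.lift_apply]
    refine Finset.sum_eq_zero fun m _ => ?_
    by_cases hm : m ∈ S.carrier
    · dsimp only
      rw [hf m hm, zero_smul]
    · dsimp only
      rw [MonoidHom.coe_mk, OneHom.coe_mk, toAdd_ofAdd, h m hm, smul_zero]

theorem lift_mon (y z : A) (h : ∀ m, m ∉ S.carrier → y ^ m.1 * z ^ m.2 = 0) (m : ℕ × ℕ) :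
    lift (k := k) y z h (mon k S m) = y ^ m.1 * z ^ m.2 := by
  refine (AddMonoidAlgebra.lift_single _ m (1 : k)).trans ?_
  rw [one_smul]
  rfl

theorem mon_eq (m : ℕ × ℕ) : mon k S m = mon k S (1, 0) ^ m.1 * mon k S (0, 1) ^ m.2 := by
  have h : ∀ (n : ℕ × ℕ) (i : ℕ), mon k S n ^ i = mon k S (i • n) := by
    intro n i
    induction i with
    | zero => rw [pow_zero, zero_smul, mon_zero]
    | succ i ih => rw [pow_succ, ih, ← mon_add, succ_nsmul]
  rw [h, h, ← mon_add]
  congr 1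
  ext <;> simp

theorem span_mon (a : MonomialAlgebra k S) :
    ∃ c : ℕ × ℕ →₀ k, a = c.sum fun m r => r • mon k S m := by
  obtain ⟨f, rfl⟩ := mk_surjective a
  refine ⟨f.coeff, ?_⟩
  conv_lhs => rw [← AddMonoidAlgebra.sum_coeff_single f]
  rw [Finsupp.sum, map_sum]
  refine Finset.sum_congr rfl fun m _ => ?_
  change _ = f.coeff m • mk k S (AddMonoidAlgebra.single m 1)
  rw [← map_smul, AddMonoidAlgebra.smul_single, smul_eq_mul, mul_one]

variable (k S) in
/-- The augmentation of a monomial algebra. -/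
def aug : MonomialAlgebra k S →ₐ[k] k :=
  lift 0 0 fun m hm => by
    rw [← pow_add, zero_pow]
    intro h
    refine hm ?_
    have : m = 0 := Prod.ext (by simp; omega) (by simp; omega)
    exact this ▸ S.zero_mem

theorem aug_mon {m : ℕ × ℕ} (hm : m ≠ 0) : aug k S (mon k S m) = 0 := by
  rw [aug, lift_mon, ← pow_add, zero_pow]
  exact fun h => hm (Prod.ext (by simp; omega) (by simp; omega))

instance : Nontrivial (MonomialAlgebra k S) := (aug k S).toRingHom.domain_nontrivial

/-- The coefficient of a monomial. -/
def coeff (m : ℕ × ℕ) (h : m ∈ S.carrier) : MonomialAlgebra k S →ₗ[k] k :=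
  Submodule.liftQ ((S.ideal k).restrictScalars k)
    { toFun := fun f : AddMonoidAlgebra k (ℕ × ℕ) => f.coeff m
      map_add' := fun _ _ => rfl
      map_smul' := fun _ _ => rfl } fun _ hf => hf m h

theorem coeff_mk (m : ℕ × ℕ) (h : m ∈ S.carrier) (f : AddMonoidAlgebra k (ℕ × ℕ)) :
    coeff m h (mk k S f) = f.coeff m := rfl

variable (k S) in
/-- The monomial basis of a monomial algebra. -/
def basis : MonomialBasis k (MonomialAlgebra k S) (ℕ × ℕ) where
  mon := mon k S
  mon_zero := mon_zero
  mon_add := mon_add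
  supp := S.carrier
  mon_eq_zero _ := mon_eq_zero
  coeff m := open Classical in if h : m ∈ S.carrier then coeff m h else 0
  coeff_mon m hm n := by
    rw [dif_pos hm]
    rw [mon, coeff_mk, AddMonoidAlgebra.coeff_single, Finsupp.single_apply]
  expand a := by
    obtain ⟨f, rfl⟩ := mk_surjective a
    rw [← sub_eq_zero]
    have : mk k S f - ∑ m ∈ S.carrier, f.coeff m • mon k S m =
        mk k S (f - ∑ m ∈ S.carrier, AddMonoidAlgebra.single m (f.coeff m)) := by
      rw [map_sub, map_sum]
      congr 1
      refine Finset.sum_congr rfl fun m _ => ?_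
      rw [mon, ← map_smul, AddMonoidAlgebra.smul_single, smul_eq_mul, mul_one]
    refine Eq.trans ?_ (this.trans ?_)
    · congr 1
      refine Finset.sum_congr rfl fun m hm => ?_
      rw [dif_pos hm, coeff_mk]
    · refine Ideal.Quotient.eq_zero_iff_mem.2 fun n hn => ?_
      rw [AddMonoidAlgebra.coeff_sub, AddMonoidAlgebra.coeff_sum, Finsupp.sub_apply,
        Finsupp.finsetSum_apply, Finset.sum_eq_single n]
      · simp
      · intro m _ hmn
        simp [hmn]
      · exact fun h => absurd hn h
  aug := aug k S
  aug_mon _ := aug_mon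

/-- The multiples of a nonzero exponent are pairwise distinct, so they cannot all stay in a finite
staircase. -/
theorem isNilpotent_mon {m : ℕ × ℕ} (hm : m ≠ 0) : IsNilpotent (mon k S m) := by
  by_contra h
  refine Set.infinite_of_injective_forall_mem (f := fun i : ℕ => i • m) ?_ ?_
    S.carrier.finite_toSet
  · intro i j hij
    have h1 := congrArg Prod.fst hij
    have h2 := congrArg Prod.snd hij
    simp only [Prod.smul_fst, Prod.smul_snd, smul_eq_mul] at h1 h2
    by_cases h0 : m.1 = 0
    · have : m.2 ≠ 0 := fun h => hm (Prod.ext h0 h)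
      exact Nat.eq_of_mul_eq_mul_right (Nat.pos_of_ne_zero this) h2
    · exact Nat.eq_of_mul_eq_mul_right (Nat.pos_of_ne_zero h0) h1
  · intro i
    refine (basis k S).mem_of_mon_ne_zero fun h0 => h ⟨i, ?_⟩
    rw [MonomialBasis.mon_nsmul] at h0
    exact h0

theorem isNilpotent_of_aug {a : MonomialAlgebra k S} (ha : aug k S a = 0) : IsNilpotent a := by
  have h := (basis k S).expand a
  rw [h]
  refine isNilpotent_sum fun m _ => ?_
  by_cases hm : m = 0
  · have : (basis k S).coeff m a = 0 := by
      rw [hm, ← (basis k S).aug_eq_coeff_zero]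
      exact ha
    rw [this, zero_smul]
    exact IsNilpotent.zero
  · exact (isNilpotent_mon hm).smul _

instance : IsLocalRing (MonomialAlgebra k S) := by
  have key : ∀ a : MonomialAlgebra k S, aug k S a ≠ 0 → IsUnit a := by
    intro a ha
    have h := IsNilpotent.isUnit_add_left_of_commute (isNilpotent_of_aug (k := k) (S := S)
      (a := a - algebraMap k _ (aug k S a)) (by simp))
      ((IsUnit.mk0 _ ha).map (algebraMap k (MonomialAlgebra k S))) (Commute.all _ _)
    rwa [add_sub_cancel] at h
  refine IsLocalRing.of_isUnit_or_isUnit_one_sub_self fun a => ?_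
  by_cases h : aug k S a = 0
  · exact Or.inr (key _ (by simp [h]))
  · exact Or.inl (key _ h)

instance : IsArtinianRing (MonomialAlgebra k S) := by
  classical
  have : Module.Finite k (MonomialAlgebra k S) := by
    refine ⟨⟨S.carrier.image (mon k S), ?_⟩⟩
    rw [eq_top_iff]
    intro a _
    rw [(basis k S).expand a]
    refine Submodule.sum_mem _ fun m hm => Submodule.smul_mem _ _ (Submodule.subset_span ?_)
    exact Finset.mem_coe.2 (Finset.mem_image_of_mem _ hm)
  exact IsArtinianRing.of_finite k _

end MonomialAlgebra

/-! ### Factorization along rays of monomials -/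

namespace MonomialBasis

variable {k : Type u} {R : Type v} {A : Type w} [Field k] [CommRing R] [Algebra k R]
  [CommRing A] [Algebra k A] [IsLocalRing A] [IsArtinianRing A]
  (B : MonomialBasis k A (ℕ × ℕ))

/-- The components of `G` along an extremal ray form a Hasse-Schmidt derivation. -/
theorem exists_ray (G : HS k R A) (w : ℕ × ℕ) (hw : w.1.Coprime w.2) (h1 : 0 < w.1)
    (hG : ∀ m ∈ B.supp, B.comp m G ≠ 0 → m = 0 ∨ (0 < m.1 ∧ w.2 * m.1 ≤ w.1 * m.2)) :
    ∃ (N : ℕ) (F : HS k R (Truncated k N)) (f : Truncated k N →ₐ[k] A),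
      f (eps k N) = B.mon w ∧ (∀ i : ℕ, i • w ∈ B.supp →
        B.comp (i • w) (HS.map f F) = B.comp (i • w) G) ∧
      ∀ n ∈ B.supp, (∀ i : ℕ, n ≠ i • w) → B.comp n (HS.map f F) = 0 := by
  have hw0 : w ≠ 0 := fun h => by simp [h] at h1
  have hinj : ∀ i j : ℕ, i • w = j • w → i = j := fun i j h =>
    Nat.eq_of_mul_eq_mul_right h1 (by simpa using congrArg Prod.fst h)
  have hex : ∃ N : ℕ, B.mon w ^ (N + 1) = 0 := by
    obtain ⟨j, hj⟩ := isNilpotent_of_mem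
      ⟨B.mon w, mem_maximalIdeal_of_aug B.aug (B.aug_mon w hw0)⟩
    exact ⟨j, pow_eq_zero_of_le (Nat.le_succ j) hj⟩
  classical
  -- With the least such `N`, all exponents `i • w` with `i ≤ N` lie in the support, where
  -- components obey the Leibniz rule.
  let N := Nat.find hex
  have hN : B.mon w ^ (N + 1) = 0 := Nat.find_spec hex
  have hmem : ∀ i : ℕ, i ≤ N → i • w ∈ B.supp := by
    intro i hi
    rcases i with _ | i
    · rw [zero_smul]
      exact B.zero_mem
    · refine B.mem_of_mon_ne_zero ?_
      rw [B.mon_nsmul]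
      exact Nat.find_min hex (m := i) hi
  let F : Derivation k R N :=
    { coeff := fun i => B.comp ((i : ℕ) • w) G
      coeff_zero := by rw [Fin.val_zero, zero_smul, B.comp_zero]
      leibniz := fun i x y => by
        rw [B.comp_leibniz (hmem i (Nat.lt_succ_iff.1 i.2))]
        symm
        refine Finset.sum_of_injOn (fun q => ((q.1 : ℕ) • w, (q.2 : ℕ) • w)) ?_ ?_ ?_ ?_
        · intro a _ b _ hab
          simp only [Prod.mk.injEq] at hab
          exact Prod.ext (Fin.ext (hinj _ _ hab.1)) (Fin.ext (hinj _ _ hab.2))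
        · intro q hq
          simp only [Finset.coe_filter, Finset.mem_univ, true_and, Set.mem_ofPred_eq,
            Finset.mem_product] at hq ⊢
          exact ⟨⟨hmem _ (Nat.lt_succ_iff.1 q.1.2), hmem _ (Nat.lt_succ_iff.1 q.2.2)⟩,
            by rw [← hq, add_smul]⟩
        -- A nonzero term has both exponents in the half plane bounded by the ray, and their sum is
        -- on the boundary. So both are on the boundary, and by coprimality both are multiples of
        -- `w`.
        · rintro ⟨m, n⟩ hq hq'
          simp only [Finset.mem_filter, Finset.mem_product] at hq
          obtain ⟨⟨hm, hn⟩, hmn⟩ := hq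
          by_contra hne
          have hm' := hG m hm fun h => hne (by simp [h])
          have hn' := hG n hn fun h => hne (by simp [h])
          have e1 : m.1 + n.1 = (i : ℕ) * w.1 := by simpa using congrArg Prod.fst hmn
          have e2 : m.2 + n.2 = (i : ℕ) * w.2 := by simpa using congrArg Prod.snd hmn
          have g1 : w.2 * m.1 ≤ w.1 * m.2 := by
            rcases hm' with h | h
            · simp [h]
            · exact h.2
          have g2 : w.2 * n.1 ≤ w.1 * n.2 := by
            rcases hn' with h | h
            · simp [h]
            · exact h.2
          have e3 : w.2 * m.1 + w.2 * n.1 = w.1 * m.2 + w.1 * n.2 := by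
            rw [← mul_add, ← mul_add, e1, e2]
            ring
          have key : ∀ l : ℕ × ℕ, w.2 * l.1 = w.1 * l.2 → ∃ j : ℕ, l = j • w := by
            intro l hl
            obtain ⟨j, hj⟩ : w.1 ∣ l.1 := hw.dvd_of_dvd_mul_left ⟨_, hl⟩
            refine ⟨j, Prod.ext (by simp [hj, mul_comm]) ?_⟩
            refine Nat.eq_of_mul_eq_mul_left h1 ?_
            rw [← hl, hj]
            simp only [Prod.smul_snd, smul_eq_mul]
            ring
          obtain ⟨a, rfl⟩ := key m (by omega)
          obtain ⟨b, rfl⟩ := key n (by omega)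
          rw [← add_smul] at hmn
          have hab := hinj _ _ hmn
          have hi := i.2
          exact hq' ⟨(⟨a, by omega⟩, ⟨b, by omega⟩), by simpa using hab, rfl⟩
        · intro q _
          rfl }
  let f : Truncated k N →ₐ[k] A := Truncated.lift (B.mon w) hN
  have hf : f (eps k N) = B.mon w := Truncated.lift_eps _ _
  have hcomp : ∀ n ∈ B.supp, ∀ r : R, B.comp n (HS.map f F.toHS) r =
      ∑ i : Fin (N + 1), if (i : ℕ) • w = n then B.comp ((i : ℕ) • w) G r else 0 := by
    intro n hn r
    rw [comp_apply, HS.map_one_tmul, Derivation.toHS_one_tmul, map_sum, map_sum]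
    refine Finset.sum_congr rfl fun i _ => ?_
    rw [Algebra.TensorProduct.map_tmul, map_pow, hf, ← B.mon_nsmul, coeffMap_tmul,
      B.coeff_mon n hn]
    split_ifs
    · rw [one_smul]
      rfl
    · rw [zero_smul]
  refine ⟨N, F.toHS, f, hf, fun i hi => ?_, fun n hn hni => ?_⟩
  · ext r
    have hiN : i < N + 1 := by
      by_contra h
      refine B.mon_ne_zero hi ?_
      rw [B.mon_nsmul]
      exact pow_eq_zero_of_le (Nat.not_lt.1 h) hN
    rw [hcomp _ hi, Finset.sum_eq_single (⟨i, hiN⟩ : Fin (N + 1))]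
    · rw [if_pos rfl]
    · intro j _ hj
      exact if_neg fun h => hj (Fin.ext (hinj _ _ h))
    · exact fun h => absurd (Finset.mem_univ _) h
  · ext r
    rw [hcomp n hn]
    exact Finset.sum_eq_zero fun i _ => if_neg fun h => hni i h.symm

variable (R) in
/-- The curves in `HS^A(R)` along the monomials divisible by both variables. -/
def interiorCurves : Set (HS k R A) :=
  {D | ∃ (N : ℕ) (w : ℕ × ℕ) (F : HS k R (Truncated k N)) (f : Truncated k N →ₐ[k] A),
    0 < w.1 ∧ 0 < w.2 ∧ f (eps k N) = B.mon w ∧ D = HS.map f F}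

/-- Splitting off the extremal ray. -/
theorem exists_peel (G : HS k R A) (w : ℕ × ℕ) (hw : w.1.Coprime w.2) (h1 : 0 < w.1)
    (h2 : 0 < w.2)
    (hG : ∀ m ∈ B.supp, B.comp m G ≠ 0 → m = 0 ∨ (0 < m.1 ∧ w.2 * m.1 ≤ w.1 * m.2)) :
    ∃ G' : HS k R A, ∃ E ∈ B.interiorCurves R, G = G' * E ∧
      ∀ m ∈ B.supp, B.comp m G' ≠ 0 → m = 0 ∨ (0 < m.1 ∧ w.2 * m.1 < w.1 * m.2) := by
  obtain ⟨N, F, f, hf, hE1, hE2⟩ := B.exists_ray G w hw h1 hG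
  refine ⟨G * (HS.map f F)⁻¹, HS.map f F, ⟨N, w, F, f, h1, h2, hf, rfl⟩,
    (inv_mul_cancel_right _ _).symm, ?_⟩
  generalize HS.map f F = E at hE1 hE2
  have hGE : G = (G * E⁻¹) * E := (inv_mul_cancel_right _ _).symm
  generalize G * E⁻¹ = G' at hGE
  -- On and below the ray `G'` has no components, by induction on the total degree of the exponent.
  have key : ∀ s : ℕ, ∀ m ∈ B.supp, m.1 + m.2 = s → m ≠ 0 →
      (m.1 = 0 ∨ w.1 * m.2 ≤ w.2 * m.1) → B.comp m G' = 0 := by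
    intro s
    induction s using Nat.strong_induction_on with
    | _ s ih =>
      intro m hm hs hm0 hlow
      -- On the ray this is the construction of `E`; strictly below it both components vanish. Given
      -- this, the convolution formula for `G = G' * E` leaves only the component of `G'` at `m`.
      have hEG : B.comp m E = B.comp m G := by
        by_cases hray : ∃ i : ℕ, m = i • w
        · obtain ⟨i, rfl⟩ := hray
          exact hE1 i hm
        · rw [hE2 m hm fun i hi => hray ⟨i, hi⟩]
          by_contra hne
          rcases hG m hm (Ne.symm hne) with h | ⟨h, h'⟩
          · exact hm0 h
          · have heq : w.2 * m.1 = w.1 * m.2 := by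
              rcases hlow with h'' | h''
              · omega
              · omega
            obtain ⟨j, hj⟩ : w.1 ∣ m.1 := hw.dvd_of_dvd_mul_left ⟨_, heq⟩
            refine hray ⟨j, Prod.ext (by simp [hj, mul_comm]) ?_⟩
            refine Nat.eq_of_mul_eq_mul_left h1 ?_
            rw [← heq, hj]
            simp only [Prod.smul_snd, smul_eq_mul]
            ring
      ext r
      have hsum := B.comp_mul hm G' E r
      rw [← hGE, ← hEG, ← Finset.sum_subset (s₁ := {(m, (0 : ℕ × ℕ)), ((0 : ℕ × ℕ), m)})] at hsum
      · rw [Finset.sum_pair (fun h => hm0 (congrArg Prod.fst h))] at hsum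
        simp only [B.comp_zero, LinearMap.id_apply] at hsum
        exact right_eq_add.1 hsum
      · intro q hq
        rw [Finset.mem_insert, Finset.mem_singleton] at hq
        rw [Finset.mem_filter, Finset.mem_product]
        rcases hq with rfl | rfl <;> simp [hm, B.zero_mem]
      · rintro ⟨l, n⟩ hq hq'
        rw [Finset.mem_filter, Finset.mem_product] at hq
        obtain ⟨⟨hl, hn⟩, hln⟩ := hq
        dsimp only at hl hn hln ⊢
        have hn0 : n ≠ 0 := by
          rintro rfl
          rw [add_zero] at hln
          subst hln
          exact hq' (Finset.mem_insert_self _ _)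
        have hl0 : l ≠ 0 := by
          rintro rfl
          rw [zero_add] at hln
          subst hln
          exact hq' (Finset.mem_insert_of_mem (Finset.mem_singleton_self _))
        -- Subtracting a positive multiple of `w` from `m` gives a smaller exponent that is still on
        -- or below the ray, so the induction hypothesis kills the mixed terms.
        by_cases hray : ∃ i : ℕ, n = i • w
        · obtain ⟨i, rfl⟩ := hray
          have hi : 0 < i := Nat.pos_of_ne_zero fun h => hn0 (by rw [h, zero_smul])
          have e1 : l.1 + i * w.1 = m.1 := by simpa using congrArg Prod.fst hln
          have e2 : l.2 + i * w.2 = m.2 := by simpa using congrArg Prod.snd hln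
          have hp : 0 < i * w.1 := Nat.mul_pos hi h1
          rw [ih (l.1 + l.2) (by omega) l hl rfl hl0, LinearMap.zero_apply]
          rcases hlow with h | h
          · omega
          · right
            rw [← e1, ← e2] at h
            have : w.1 * (i * w.2) = w.2 * (i * w.1) := by ring
            rw [mul_add, mul_add] at h
            omega
        · rw [hE2 n hn fun i hi => hray ⟨i, hi⟩, LinearMap.zero_apply, map_zero]
  intro m hm hne
  by_contra hcon
  push Not at hcon
  exact hne (key _ m hm rfl hcon.1 ((Nat.eq_zero_or_pos m.1).imp_right hcon.2))

/-- An element of `HS^A(R)` without components on the coordinate axes is a product of curves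
along monomials divisible by both variables. -/
theorem mem_closure_interiorCurves (G : HS k R A)
    (hG : ∀ m ∈ B.supp, m ≠ 0 → (m.1 = 0 ∨ m.2 = 0) → B.comp m G = 0) :
    G ∈ Subgroup.closure (B.interiorCurves R) := by
  -- `T s` collects the exponents of slope greater than `s`. Each peeling raises the bound `s` to an
  -- attained slope, so the cardinality of `T s` drops.
  let T : ℚ → Finset (ℕ × ℕ) := fun s => {m ∈ B.supp | 0 < m.1 ∧ s < (m.2 : ℚ) / m.1}
  have main : ∀ c : ℕ, ∀ s : ℚ, 0 ≤ s → (T s).card = c → ∀ G : HS k R A,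
      (∀ m ∈ B.supp, B.comp m G ≠ 0 → m = 0 ∨ m ∈ T s) →
      G ∈ Subgroup.closure (B.interiorCurves R) := by
    intro c
    induction c using Nat.strong_induction_on with
    | _ c ih =>
      intro s hs hc G hG
      classical
      rcases Finset.eq_empty_or_nonempty {m ∈ B.supp | m ≠ 0 ∧ B.comp m G ≠ 0} with h | h
      · rw [B.eq_one_of_comp (D := G)]
        · exact one_mem _
        · intro m hm hm0
          by_contra hne
          have : m ∈ ({m ∈ B.supp | m ≠ 0 ∧ B.comp m G ≠ 0} : Finset (ℕ × ℕ)) :=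
            Finset.mem_filter.2 ⟨hm, hm0, hne⟩
          rw [h] at this
          exact absurd this (Finset.notMem_empty _)
      · obtain ⟨a, ha, hmin⟩ := Finset.exists_min_image _ (fun m : ℕ × ℕ => (m.2 : ℚ) / m.1) h
        rw [Finset.mem_filter] at ha
        obtain ⟨ha, ha0, hane⟩ := ha
        have haT := (hG a ha hane).resolve_left ha0
        obtain ⟨-, ha1, has⟩ := Finset.mem_filter.1 haT
        have ha2 : 0 < a.2 := by
          rw [Nat.pos_iff_ne_zero]
          intro h0
          rw [h0, Nat.cast_zero, zero_div] at has
          linarith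
        have hg : 0 < a.1.gcd a.2 := Nat.gcd_pos_of_pos_left _ ha1
        -- The primitive vector on the ray of minimal slope; it is interior because that slope is
        -- positive.
        obtain ⟨g, b1, b2, hgpos, hcop, e1, e2⟩ :=
          Nat.exists_coprime' (m := a.1) (n := a.2) hg
        have hb1 : 0 < b1 := Nat.pos_of_ne_zero fun h0 => by simp [h0] at e1; omega
        have hb2 : 0 < b2 := Nat.pos_of_ne_zero fun h0 => by simp [h0] at e2; omega
        have hslope : (a.2 : ℚ) / a.1 = (b2 : ℚ) / b1 := by
          rw [e1, e2, Nat.cast_mul, Nat.cast_mul]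
          exact mul_div_mul_right _ _ (by positivity)
        obtain ⟨G', E, hE, hGE, hG'⟩ := B.exists_peel G (b1, b2) hcop hb1 hb2 (by
          intro m hm hne
          by_cases hm0 : m = 0
          · exact Or.inl hm0
          · right
            have hmT := (hG m hm hne).resolve_left hm0
            obtain ⟨-, hm1, -⟩ := Finset.mem_filter.1 hmT
            refine ⟨hm1, ?_⟩
            have := hmin m (Finset.mem_filter.2 ⟨hm, hm0, hne⟩)
            rw [hslope, div_le_div_iff₀ (by positivity) (by positivity)] at this
            have h' : b2 * m.1 ≤ m.2 * b1 := by exact_mod_cast this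
            rwa [mul_comm m.2] at h')
        rw [hGE]
        refine mul_mem ?_ (Subgroup.subset_closure hE)
        refine ih (T ((b2 : ℚ) / b1)).card ?_ _ (by positivity) rfl G' ?_
        · rw [← hc]
          refine Finset.card_lt_card (Finset.ssubset_iff_subset_ne.2 ⟨?_, ?_⟩)
          · intro m hm
            obtain ⟨hm, hm1, hms⟩ := Finset.mem_filter.1 hm
            exact Finset.mem_filter.2 ⟨hm, hm1, has.trans (hslope ▸ hms)⟩
          · intro heq
            rw [← heq] at haT
            obtain ⟨-, -, h'⟩ := Finset.mem_filter.1 haT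
            rw [hslope] at h'
            exact lt_irrefl _ h'
        · intro m hm hne
          refine (hG' m hm hne).imp_right fun h' => ?_
          refine Finset.mem_filter.2 ⟨hm, h'.1, ?_⟩
          have h1 := h'.1
          rw [div_lt_div_iff₀ (by positivity) (by positivity)]
          have h2 := h'.2
          rw [mul_comm _ m.2] at h2
          exact_mod_cast h2
  refine main _ 0 le_rfl rfl G fun m hm hne => ?_
  by_cases hm0 : m = 0
  · exact Or.inl hm0
  · right
    have h1 : m.1 ≠ 0 := fun h => hne (hG m hm hm0 (Or.inl h))
    have h2 : m.2 ≠ 0 := fun h => hne (hG m hm hm0 (Or.inr h))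
    exact Finset.mem_filter.2 ⟨hm, Nat.pos_of_ne_zero h1, by positivity⟩

end MonomialBasis

/-! ### Automorphisms trivial on both coordinate axes -/

namespace MonomialAlgebra

variable {k : Type u} [Field k] {S : Staircase} {R : Type v} [CommRing R] [Algebra k R]

variable (k S) in
/-- The endomorphism of a monomial algebra which kills the second variable. -/
def killRight : MonomialAlgebra k S →ₐ[k] MonomialAlgebra k S :=
  lift (mon k S (1, 0)) 0 fun m hm => by
    by_cases h : m.2 = 0
    · rw [h, pow_zero, mul_one, ← mon_eq_zero (k := k) hm, mon_eq (k := k) m, h, pow_zero, mul_one]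
    · rw [zero_pow h, mul_zero]

variable (k S) in
/-- The endomorphism of a monomial algebra which kills the first variable. -/
def killLeft : MonomialAlgebra k S →ₐ[k] MonomialAlgebra k S :=
  lift 0 (mon k S (0, 1)) fun m hm => by
    by_cases h : m.1 = 0
    · rw [h, pow_zero, one_mul, ← mon_eq_zero (k := k) hm, mon_eq (k := k) m, h, pow_zero, one_mul]
    · rw [zero_pow h, zero_mul]

/-- An element of `HS(k[x, y] / I)` that is trivial modulo `x` and modulo `y` is a product of
curves along monomials divisible by `x y`. -/
theorem mem_closure_interiorCurves (G : HS k R (MonomialAlgebra k S))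
    (hr : HS.map (killRight k S) G = 1) (hl : HS.map (killLeft k S) G = 1) :
    G ∈ Subgroup.closure ((basis k S).interiorCurves R) := by
  refine MonomialBasis.mem_closure_interiorCurves _ G fun m hm hm0 haxis => ?_
  rcases haxis with h | h
  · refine MonomialBasis.comp_eq_zero_of_map _ (P := fun m => m.1 = 0) (fun n hn => ?_)
      (fun n hn => ?_) hl hm h hm0
    · change killLeft k S (mon k S n) = mon k S n
      rw [killLeft, lift_mon, mon_eq (k := k) n, hn, pow_zero, pow_zero]
    · change killLeft k S (mon k S n) = 0
      rw [killLeft, lift_mon, zero_pow hn, zero_mul]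
  · refine MonomialBasis.comp_eq_zero_of_map _ (P := fun m => m.2 = 0) (fun n hn => ?_)
      (fun n hn => ?_) hr hm h hm0
    · change killRight k S (mon k S n) = mon k S n
      rw [killRight, lift_mon, mon_eq (k := k) n, hn, pow_zero, pow_zero]
    · change killRight k S (mon k S n) = 0
      rw [killRight, lift_mon, zero_pow hn, mul_zero]

end MonomialAlgebra

/-! ### Obstructions to lifting along small extensions -/

section Obstruction

variable {k : Type u} {R : Type v} [Field k] [CommRing R] [Algebra k R]

variable (k R) in
/-- The polynomial ring on the elements of `R`. -/
abbrev Cover : Type (max u v) := MvPolynomial R k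

variable (k R) in
/-- The tautological presentation of `R` by a polynomial ring. -/
def coverMap : Cover k R →ₐ[k] R := MvPolynomial.aeval id

@[simp]
theorem coverMap_X (r : R) : coverMap k R (MvPolynomial.X r) = r := MvPolynomial.aeval_X _ _

theorem coverMap_surjective : Function.Surjective (coverMap k R) := fun r => ⟨_, coverMap_X r⟩

variable (k R) in
/-- The relations of the tautological presentation. -/
abbrev Relations : Submodule k (Cover k R) := LinearMap.ker (coverMap k R).toLinearMap

theorem coverMap_relation (j : Relations k R) : coverMap k R j = 0 := j.2

variable {A : Type w} {A' : Type w'} [CommRing A] [Algebra k A] [CommRing A'] [Algebra k A']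

/-- The map `A ⊗ P → A' ⊗ R` for the presentation `P → R` and a homomorphism `A → A'`. -/
def coverTensor (π : A →ₐ[k] A') : A ⊗[k] Cover k R →ₐ[k] A' ⊗[k] R :=
  Algebra.TensorProduct.map π (coverMap k R)

@[simp]
theorem coverTensor_tmul (π : A →ₐ[k] A') (a : A) (p : Cover k R) :
    coverTensor π (a ⊗ₜ[k] p) = π a ⊗ₜ[k] coverMap k R p :=
  Algebra.TensorProduct.map_tmul ..

theorem coverTensor_smul (π : A →ₐ[k] A') (a : A) (z : A ⊗[k] Cover k R) :
    coverTensor π (a • z) = π a • coverTensor π z := by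
  induction z using TensorProduct.induction_on with
  | zero => simp only [smul_zero, map_zero]
  | tmul b r => rw [TensorProduct.smul_tmul', coverTensor_tmul, coverTensor_tmul,
      TensorProduct.smul_tmul', smul_eq_mul, smul_eq_mul, map_mul]
  | add x y hx hy => simp only [smul_add, map_add, hx, hy]

theorem tensorMap_coverTensor {A'' : Type w''} [CommRing A''] [Algebra k A''] (g : A' →ₐ[k] A'')
    (π : A →ₐ[k] A') (z : A ⊗[k] Cover k R) :
    tensorMap R g (coverTensor π z) = coverTensor (g.comp π) z := by
  induction z using TensorProduct.induction_on with
  | zero => simp only [map_zero]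
  | tmul a r => rfl
  | add x y hx hy => simp only [map_add, hx, hy]

theorem coverTensor_tensorMap {A'' : Type w''} [CommRing A''] [Algebra k A''] (g : A' →ₐ[k] A'')
    (π : A →ₐ[k] A') (z : A ⊗[k] Cover k R) :
    coverTensor g (tensorMap (Cover k R) π z) = coverTensor (g.comp π) z := by
  induction z using TensorProduct.induction_on with
  | zero => simp only [map_zero]
  | tmul a r => rfl
  | add x y hx hy => simp only [map_add, hx, hy]

variable [IsLocalRing A] [IsArtinianRing A] [IsLocalRing A'] [IsArtinianRing A']

theorem augment_coverTensor (e : A →ₐ[k] k) (π : A →ₐ[k] A') (e' : A' →ₐ[k] k)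
    (z : A ⊗[k] Cover k R) :
    augment R e' (coverTensor π z) = coverMap k R (augment (Cover k R) e z) := by
  induction z using TensorProduct.induction_on with
  | zero => simp only [map_zero]
  | tmul a r =>
    rw [coverTensor_tmul, augment_tmul, augment_tmul, map_smul, ← aug_comp e e' π]
    rfl
  | add x y hx hy => simp only [map_add, hx, hy]

/-- An automorphism `Φ ∈ HS^A(P)` covers `D ∈ HS^{A'}(R)`. -/
def Covers (π : A →ₐ[k] A') (Φ : HS k (Cover k R) A) (D : HS k R A') : Prop :=
  ∀ z, coverTensor π (Φ.1 z) = D.1 (coverTensor π z)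

theorem covers_of_X (π : A →ₐ[k] A') (Φ : HS k (Cover k R) A) (D : HS k R A')
    (h : ∀ r : R, coverTensor π (Φ.1 (1 ⊗ₜ[k] MvPolynomial.X r)) = D.1 (1 ⊗ₜ[k] r)) :
    Covers π Φ D := by
  have key : (((coverTensor π).comp (Φ.1.toAlgHom.restrictScalars k)).comp
      Algebra.TensorProduct.includeRight : Cover k R →ₐ[k] A' ⊗[k] R) =
      ((D.1.toAlgHom.restrictScalars k).comp Algebra.TensorProduct.includeRight).comp
        (coverMap k R) := by
    refine MvPolynomial.algHom_ext fun r => ?_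
    refine (h r).trans ?_
    simp
  intro z
  induction z using TensorProduct.induction_on with
  | zero => simp only [map_zero]
  | tmul a p =>
    have : a ⊗ₜ[k] p = a • ((1 : A) ⊗ₜ[k] p) := by
      rw [TensorProduct.smul_tmul', smul_eq_mul, mul_one]
    rw [this, map_smul, coverTensor_smul, coverTensor_smul, map_smul]
    congr 1
    refine (DFunLike.congr_fun key p).trans ?_
    simp
  | add x y hx hy => simp only [map_add, hx, hy]

/-- A prescription of the images of the variables that lifts the identity defines an element of
`HS^A(P)`. -/
theorem exists_hs_cover (e : A →ₐ[k] k) (x : R → A ⊗[k] Cover k R)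
    (hx : ∀ r, augment (Cover k R) e (x r) = MvPolynomial.X r) :
    ∃ Φ : HS k (Cover k R) A, ∀ r, Φ.1 (1 ⊗ₜ[k] MvPolynomial.X r) = x r := by
  have key : (augment (Cover k R) e).comp (MvPolynomial.aeval x) = AlgHom.id k _ :=
    MvPolynomial.algHom_ext fun r => by simp [hx]
  have hf : ∀ p : Cover k R, augment (Cover k R) e (MvPolynomial.aeval x p) = p :=
    fun p => DFunLike.congr_fun key p
  refine ⟨HS.lift e (MvPolynomial.aeval x) hf, fun r => ?_⟩
  rw [HS.lift_one_tmul, MvPolynomial.aeval_X]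

/-- A polynomial ring is free, so any lifts of the elements `D (1 ⊗ r)` that reduce to the variables
will serve as images of the variables. -/
theorem exists_covers (e : A →ₐ[k] k) (π : A →ₐ[k] A') (hπ : Function.Surjective π)
    (e' : A' →ₐ[k] k) (D : HS k R A') : ∃ Φ : HS k (Cover k R) A, Covers π Φ D := by
  have hex : ∀ r : R, ∃ x : A ⊗[k] Cover k R, coverTensor π x = D.1 (1 ⊗ₜ[k] r) ∧
      augment (Cover k R) e x = MvPolynomial.X r := by
    intro r
    obtain ⟨z, hz⟩ := Algebra.TensorProduct.map_surjective π (coverMap k R) hπ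
      coverMap_surjective (D.1 (1 ⊗ₜ[k] r))
    change coverTensor π z = _ at hz
    -- An arbitrary preimage `z` may reduce to the wrong polynomial. The error is a relation, so
    -- subtracting it does not change the image in `A' ⊗ R`.
    refine ⟨z - 1 ⊗ₜ[k] (augment (Cover k R) e z - MvPolynomial.X r), ?_, ?_⟩
    · rw [map_sub, hz, coverTensor_tmul, map_sub, ← augment_coverTensor e π e', hz,
        HS.augment_apply, augment_tmul, map_one, map_one, one_smul, coverMap_X, sub_self,
        TensorProduct.tmul_zero, sub_zero]
    · rw [map_sub, augment_tmul, map_one, one_smul, sub_sub_cancel]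
  choose x hx hx' using hex
  obtain ⟨Φ, hΦ⟩ := exists_hs_cover e x hx'
  exact ⟨Φ, covers_of_X π Φ D fun r => by rw [hΦ, hx]⟩

theorem Covers.mul {π : A →ₐ[k] A'} {Φ Ψ : HS k (Cover k R) A} {D E : HS k R A'}
    (h : Covers π Φ D) (h' : Covers π Ψ E) : Covers π (Φ * Ψ) (D * E) := fun z => by
  change coverTensor π (Φ.1 (Ψ.1 z)) = D.1 (E.1 _)
  rw [h, h']

theorem Covers.inv {π : A →ₐ[k] A'} {Φ : HS k (Cover k R) A} {D : HS k R A'}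
    (h : Covers π Φ D) : Covers π Φ⁻¹ D⁻¹ := fun z => by
  have hz := h (Φ⁻¹.1 z)
  have h1 : Φ.1 (Φ⁻¹.1 z) = z := Φ.1.apply_symm_apply z
  have h2 : ∀ y, D⁻¹.1 (D.1 y) = y := fun y => D.1.symm_apply_apply y
  rw [h1] at hz
  rw [hz, h2]

/-- A small extension: `π` is surjective, its kernel is the line spanned by `t ≠ 0`, and `t` is
annihilated by the maximal ideal. -/
structure IsSmall (π : A →ₐ[k] A') (t : A) : Prop where
  surjective : Function.Surjective π
  map_eq_zero_iff : ∀ a, π a = 0 ↔ ∃ c : k, c • t = a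
  ne_zero : t ≠ 0
  mul_eq_zero : ∀ a ∈ IsLocalRing.maximalIdeal A, a * t = 0

namespace IsSmall

variable {π : A →ₐ[k] A'} {t : A} (h : IsSmall π t)

include h

theorem map_t : π t = 0 := (h.map_eq_zero_iff t).2 ⟨1, one_smul _ _⟩

theorem mem_maximalIdeal : t ∈ IsLocalRing.maximalIdeal A :=
  (IsLocalRing.mem_maximalIdeal t).2 fun hu => (h.map_t ▸ hu.map π).ne_zero rfl

theorem smul_tmul (e : A →ₐ[k] k) (a : A) (r : R) : a • (t ⊗ₜ[k] r) = t ⊗ₜ[k] (e a • r) := by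
  have h1 : (a - algebraMap k A (e a)) * t = 0 :=
    h.mul_eq_zero _ (mem_maximalIdeal_of_aug e (by simp))
  rw [sub_mul, sub_eq_zero, ← Algebra.smul_def] at h1
  rw [TensorProduct.smul_tmul', smul_eq_mul, h1, TensorProduct.smul_tmul]

theorem t_smul (e : A →ₐ[k] k) (z : A ⊗[k] R) : t • z = t ⊗ₜ[k] augment R e z := by
  induction z using TensorProduct.induction_on with
  | zero => simp only [smul_zero, map_zero, TensorProduct.tmul_zero]
  | tmul a r =>
    have : a ⊗ₜ[k] r = a • ((1 : A) ⊗ₜ[k] r) := by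
      rw [TensorProduct.smul_tmul', smul_eq_mul, mul_one]
    rw [augment_tmul, ← h.smul_tmul, this, smul_comm, TensorProduct.smul_tmul', smul_eq_mul,
      mul_one]
  | add x y hx hy => simp only [smul_add, map_add, hx, hy, TensorProduct.tmul_add]

/-- The sequence `k → A → A' → 0` given by `t` and `π` stays exact after tensoring with `R`. -/
theorem eq_tmul_of_tensorMap_eq_zero {z : A ⊗[k] R} (hz : tensorMap R π z = 0) :
    ∃ r : R, z = t ⊗ₜ[k] r := by
  have hex : Function.Exact (LinearMap.toSpanSingleton k A t) π.toLinearMap := fun a => by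
    rw [Set.mem_range]
    exact h.map_eq_zero_iff a
  obtain ⟨y, hy⟩ := (rTensor_exact R hex h.surjective z).1 hz
  refine ⟨TensorProduct.lid k R y, ?_⟩
  rw [← hy]
  clear hy
  induction y using TensorProduct.induction_on with
  | zero => simp
  | tmul c r => simp [TensorProduct.smul_tmul]
  | add x y hx hy => simp only [map_add, hx, hy, TensorProduct.tmul_add]

theorem tmul_injective : Function.Injective (TensorProduct.mk k A R t) := by
  have h1 : Function.Injective (LinearMap.toSpanSingleton k A t) :=
    LinearMap.ker_eq_bot.1 (LinearMap.ker_toSpanSingleton k h.ne_zero)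
  have h2 := Module.Flat.rTensor_preserves_injective_linearMap (M := R) _ h1
  intro r s hrs
  have := @h2 (1 ⊗ₜ r) (1 ⊗ₜ s) (by simpa using hrs)
  simpa using congrArg (TensorProduct.lid k R) this

end IsSmall

/-- `f` represents the obstruction to lifting `D ∈ HS^{A'}(R)` along the small extension `A → A'`
with kernel `k t`. -/
def Obs (π : A →ₐ[k] A') (t : A) (D : HS k R A') (f : Relations k R →ₗ[k] R) : Prop :=
  ∃ Φ : HS k (Cover k R) A, Covers π Φ D ∧
    ∀ j : Relations k R, coverTensor (AlgHom.id k A) (Φ.1 (1 ⊗ₜ[k] (j : Cover k R))) = t ⊗ₜ[k] f j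

section

variable {π : A →ₐ[k] A'} {t : A} (h : IsSmall π t) (e : A →ₐ[k] k) (e' : A' →ₐ[k] k)

include h

theorem tensorMap_coverTensor_id (z : A ⊗[k] Cover k R) :
    tensorMap R π (coverTensor (AlgHom.id k A) z) = coverTensor π z :=
  tensorMap_coverTensor _ _ _

include e e' in
-- Any cover of `D` sends relations to zero in `A' ⊗ R`, hence into `t ⊗ R` after reduction to `A ⊗
-- R`; and `r ↦ t ⊗ r` is injective.
theorem Obs.exists (D : HS k R A') : ∃ f, Obs π t D f := by
  obtain ⟨Φ, hΦ⟩ := exists_covers e π h.surjective e' D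
  let τ : R ≃ₗ[k] LinearMap.range (TensorProduct.mk k A R t) :=
    LinearEquiv.ofInjective _ h.tmul_injective
  let g : Relations k R →ₗ[k] A ⊗[k] R :=
    (coverTensor (AlgHom.id k A)).toLinearMap ∘ₗ Φ.1.toLinearMap.restrictScalars k ∘ₗ
      TensorProduct.mk k A (Cover k R) 1 ∘ₗ (Relations k R).subtype
  have hg : ∀ j, g j ∈ LinearMap.range (TensorProduct.mk k A R t) := by
    intro j
    obtain ⟨r, hr⟩ := h.eq_tmul_of_tensorMap_eq_zero (z := g j) (by
      change tensorMap R π (coverTensor (AlgHom.id k A) (Φ.1 (1 ⊗ₜ[k] (j : Cover k R)))) = 0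
      rw [tensorMap_coverTensor_id h, hΦ, coverTensor_tmul, coverMap_relation,
        TensorProduct.tmul_zero, map_zero])
    exact ⟨r, hr.symm⟩
  refine ⟨τ.symm.toLinearMap ∘ₗ g.codRestrict _ hg, Φ, hΦ, fun j => ?_⟩
  have := congrArg Subtype.val (τ.apply_symm_apply (g.codRestrict _ hg j))
  exact this.symm

/-- This makes the obstruction additive. For a lift `p` of `r`, the difference `z - t ⊗ p` lies in
`A ⊗ J`, where `Φ` acts through `f` and the augmentation because `𝔪_A` kills `t`; for the same
reason `Φ` has no effect on `t ⊗ p`. -/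
theorem Obs.apply_of_eq {Φ : HS k (Cover k R) A} {f : Relations k R →ₗ[k] R}
    (hf : ∀ j : Relations k R,
      coverTensor (AlgHom.id k A) (Φ.1 (1 ⊗ₜ[k] (j : Cover k R))) = t ⊗ₜ[k] f j)
    {z : A ⊗[k] Cover k R} {r : R} (j : Relations k R)
    (hz : coverTensor (AlgHom.id k A) z = t ⊗ₜ[k] r)
    (hj : augment (Cover k R) e z = j) :
    coverTensor (AlgHom.id k A) (Φ.1 z) = t ⊗ₜ[k] (r + f j) := by
  obtain ⟨p, rfl⟩ := coverMap_surjective (k := k) r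
  have h0 : (coverMap k R).toLinearMap.lTensor A (z - t ⊗ₜ[k] p) = 0 := by
    change coverTensor (AlgHom.id k A) (z - t ⊗ₜ[k] p) = 0
    rw [map_sub, hz, coverTensor_tmul]
    exact sub_self _
  have hex : Function.Exact (Relations k R).subtype (coverMap k R).toLinearMap :=
    LinearMap.exact_subtype_ker_map _
  obtain ⟨y, hy⟩ := (lTensor_exact A hex coverMap_surjective _).1 h0
  have key : ∀ y : A ⊗[k] Relations k R, ∃ i : Relations k R,
      augment (Cover k R) e ((Relations k R).subtype.lTensor A y) = i ∧
      coverTensor (AlgHom.id k A) (Φ.1 ((Relations k R).subtype.lTensor A y)) = t ⊗ₜ[k] f i := by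
    intro y
    induction y using TensorProduct.induction_on with
    | zero => exact ⟨0, by simp⟩
    | tmul a i =>
      refine ⟨e a • i, by simp, ?_⟩
      have : a ⊗ₜ[k] (i : Cover k R) = a • ((1 : A) ⊗ₜ[k] (i : Cover k R)) := by
        rw [TensorProduct.smul_tmul', smul_eq_mul, mul_one]
      rw [LinearMap.lTensor_tmul, Submodule.subtype_apply, this, map_smul, coverTensor_smul, hf,
        AlgHom.id_apply, h.smul_tmul e, map_smul]
    | add x y hx hy =>
      obtain ⟨i, hi, hi'⟩ := hx
      obtain ⟨i', hj, hj'⟩ := hy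
      refine ⟨i + i', ?_, ?_⟩
      · rw [map_add, map_add, hi, hj]
        rfl
      · rw [map_add, map_add, map_add, hi', hj', map_add, TensorProduct.tmul_add]
  obtain ⟨i, hi, hi'⟩ := key y
  rw [hy] at hi hi'
  have hij : i = j := by
    refine Subtype.ext ?_
    rw [← hi, map_sub, hj, augment_tmul, aug_eq_zero e h.mem_maximalIdeal, zero_smul, sub_zero]
  have htp : coverTensor (AlgHom.id k A) (Φ.1 (t ⊗ₜ[k] p)) = t ⊗ₜ[k] coverMap k R p := by
    have : t ⊗ₜ[k] p = t • ((1 : A) ⊗ₜ[k] p) := by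
      rw [TensorProduct.smul_tmul', smul_eq_mul, mul_one]
    rw [this, map_smul, coverTensor_smul, AlgHom.id_apply, h.t_smul e,
      augment_coverTensor e _ e, HS.augment_apply, augment_tmul, map_one, one_smul]
  rw [map_sub, map_sub, htp, hij, sub_eq_iff_eq_add] at hi'
  rw [hi', ← TensorProduct.tmul_add, add_comm]

include e in
-- The composite of two covers covers the composite, and `Φ` merely adds `t ⊗ f j` to the value `t ⊗
-- g j` coming from `Ψ`.
theorem Obs.mul {D E : HS k R A'} {f g : Relations k R →ₗ[k] R} (hf : Obs π t D f)
    (hg : Obs π t E g) : Obs π t (D * E) (f + g) := by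
  obtain ⟨Φ, hΦ, hf⟩ := hf
  obtain ⟨Ψ, hΨ, hg⟩ := hg
  refine ⟨Φ * Ψ, hΦ.mul hΨ, fun j => ?_⟩
  refine (Obs.apply_of_eq h e hf j (hg j) ?_).trans ?_
  · rw [HS.augment_apply, augment_tmul, map_one, one_smul]
  · rw [LinearMap.add_apply, add_comm]

theorem Obs.one : Obs π t (1 : HS k R A') 0 :=
  ⟨1, fun _ => rfl, fun j => by
    change coverTensor (AlgHom.id k A) (1 ⊗ₜ[k] (j : Cover k R)) = _
    rw [coverTensor_tmul, coverMap_relation, TensorProduct.tmul_zero, LinearMap.zero_apply,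
      TensorProduct.tmul_zero]⟩

include e in
theorem Obs.inv {D : HS k R A'} {f : Relations k R →ₗ[k] R} (hf : Obs π t D f) :
    Obs π t D⁻¹ (-f) := by
  obtain ⟨Φ, hΦ, hf⟩ := hf
  refine ⟨Φ⁻¹, hΦ.inv, fun j => ?_⟩
  obtain ⟨r, hr⟩ := h.eq_tmul_of_tensorMap_eq_zero
    (z := coverTensor (AlgHom.id k A) (Φ⁻¹.1 (1 ⊗ₜ[k] (j : Cover k R)))) (by
      rw [tensorMap_coverTensor_id h, hΦ.inv, coverTensor_tmul, coverMap_relation,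
        TensorProduct.tmul_zero, map_zero])
  have h1 := Obs.apply_of_eq h e hf j hr (by
    rw [HS.augment_apply, augment_tmul, map_one, one_smul])
  have h2 : Φ.1 (Φ⁻¹.1 (1 ⊗ₜ[k] (j : Cover k R))) = 1 ⊗ₜ[k] (j : Cover k R) :=
    Φ.1.apply_symm_apply _
  rw [h2, coverTensor_tmul, coverMap_relation, TensorProduct.tmul_zero] at h1
  have h3 : r + f j = 0 := h.tmul_injective (by
    rw [TensorProduct.mk_apply, ← h1, map_zero])
  rw [hr, LinearMap.neg_apply, eq_neg_of_add_eq_zero_left h3]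

include e e' in
/-- `D` lifts if its obstruction vanishes. -/
theorem Obs.exists_lift {D : HS k R A'} (hD : Obs π t D 0) : ∃ E : HS k R A, HS.map π E = D := by
  obtain ⟨Φ, hΦ, hf⟩ := hD
  -- Zero obstruction means that `ψ` vanishes on the relations, so it descends to `R`; the variables
  -- `X r` serve as set-theoretic representatives.
  let ψ : Cover k R →ₐ[k] A ⊗[k] R := (coverTensor (AlgHom.id k A)).comp
    ((Φ.1.toAlgHom.restrictScalars k).comp Algebra.TensorProduct.includeRight)
  have hψ : ∀ p, coverMap k R p = 0 → ψ p = 0 := fun p hp => by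
    refine (hf ⟨p, hp⟩).trans ?_
    rw [LinearMap.zero_apply, TensorProduct.tmul_zero]
  have hψ' : ∀ p p', coverMap k R p = coverMap k R p' → ψ p = ψ p' := fun p p' hp => by
    rw [← sub_eq_zero, ← map_sub]
    exact hψ _ (by rw [map_sub, hp, sub_self])
  let g : R →ₐ[k] A ⊗[k] R :=
    { toFun := fun r => ψ (MvPolynomial.X r)
      map_one' := by rw [← map_one ψ]; exact hψ' _ _ (by simp)
      map_mul' := fun r s => by rw [← map_mul]; exact hψ' _ _ (by simp)
      map_zero' := hψ _ (by simp)
      map_add' := fun r s => by rw [← map_add]; exact hψ' _ _ (by simp)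
      commutes' := fun c => by rw [← AlgHom.commutes ψ]; exact hψ' _ _ (by simp) }
  refine ⟨HS.lift e g fun r => ?_, HS.ext fun r => ?_⟩
  · change augment R e (coverTensor (AlgHom.id k A) (Φ.1 (1 ⊗ₜ[k] MvPolynomial.X r))) = r
    rw [augment_coverTensor e _ e, HS.augment_apply, augment_tmul, map_one, one_smul, coverMap_X]
  · rw [HS.map_one_tmul, HS.lift_one_tmul]
    change tensorMap R π (coverTensor (AlgHom.id k A) (Φ.1 (1 ⊗ₜ[k] MvPolynomial.X r))) = _
    rw [tensorMap_coverTensor_id h, hΦ, coverTensor_tmul, map_one, coverMap_X]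

include e in
/-- The obstruction of an element that lifts vanishes. -/
theorem Obs.map_zero (E : HS k R A) : Obs π t (HS.map π E) 0 := by
  obtain ⟨Φ, hΦ⟩ := exists_covers e (AlgHom.id k A) Function.surjective_id e E
  refine ⟨Φ, fun z => ?_, fun j => ?_⟩
  · rw [← tensorMap_coverTensor_id h, hΦ, ← HS.map_apply_tensorMap, tensorMap_coverTensor_id h]
  · rw [hΦ, coverTensor_tmul, coverMap_relation, TensorProduct.tmul_zero, _root_.map_zero,
      LinearMap.zero_apply, TensorProduct.tmul_zero]

end

/-- Naturality of the obstruction. -/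
theorem Obs.map {B : Type*} {B' : Type*} [CommRing B] [Algebra k B] [CommRing B'] [Algebra k B']
    [IsLocalRing B] [IsArtinianRing B] [IsLocalRing B'] [IsArtinianRing B']
    {π : A →ₐ[k] A'} {t : A} {ρ : B →ₐ[k] B'} {s : B} (g : A →ₐ[k] B) (g' : A' →ₐ[k] B')
    (hcomm : ρ.comp g = g'.comp π) (c : k) (hc : g t = c • s) {D : HS k R A'}
    {f : Relations k R →ₗ[k] R} (hf : Obs π t D f) : Obs ρ s (HS.map g' D) (c • f) := by
  obtain ⟨Φ, hΦ, hf⟩ := hf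
  refine ⟨HS.map g Φ, covers_of_X _ _ _ fun r => ?_, fun j => ?_⟩
  · rw [HS.map_one_tmul, HS.map_one_tmul, coverTensor_tensorMap, hcomm, ← tensorMap_coverTensor,
      hΦ, coverTensor_tmul, map_one, coverMap_X]
  · rw [HS.map_one_tmul, coverTensor_tensorMap, AlgHom.id_comp]
    have h1 : ∀ z : A ⊗[k] Cover k R,
        coverTensor g z = tensorMap R g (coverTensor (AlgHom.id k A) z) := fun z => by
      rw [tensorMap_coverTensor, AlgHom.comp_id]
    rw [h1, hf, Algebra.TensorProduct.map_tmul, hc, TensorProduct.smul_tmul]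
    rfl

/-- The restriction of a derivation `P → R` to the relations. -/
def IsDerivationRestriction (f : Relations k R →ₗ[k] R) : Prop :=
  ∃ δ : Cover k R →ₗ[k] R, (∀ a b, δ (a * b) = coverMap k R a * δ b + δ a * coverMap k R b) ∧
    ∀ j : Relations k R, f j = δ j

section

variable {π : A →ₐ[k] A'} {t : A} (h : IsSmall π t) (e : A →ₐ[k] k)

include h

theorem IsSmall.mul_self : t * t = 0 := h.mul_eq_zero _ h.mem_maximalIdeal

include e in
-- A cover of the identity has the form `1 ⊗ p + t ⊗ δ p` in `A ⊗ R`, and `t * t = 0` makes `δ` a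
-- derivation. Together with `Obs.mul` and `Obs.inv` this bounds the ambiguity of the obstruction.
theorem Obs.isDerivationRestriction {f : Relations k R →ₗ[k] R} (hf : Obs π t (1 : HS k R A') f) :
    IsDerivationRestriction f := by
  obtain ⟨Φ, hΦ, hf⟩ := hf
  let ψ : Cover k R →ₐ[k] A ⊗[k] R := (coverTensor (AlgHom.id k A)).comp
    ((Φ.1.toAlgHom.restrictScalars k).comp Algebra.TensorProduct.includeRight)
  let τ : R ≃ₗ[k] LinearMap.range (TensorProduct.mk k A R t) :=
    LinearEquiv.ofInjective _ h.tmul_injective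
  let g : Cover k R →ₗ[k] A ⊗[k] R :=
    ψ.toLinearMap - TensorProduct.mk k A R 1 ∘ₗ (coverMap k R).toLinearMap
  have hg : ∀ p, g p ∈ LinearMap.range (TensorProduct.mk k A R t) := by
    intro p
    obtain ⟨r, hr⟩ := h.eq_tmul_of_tensorMap_eq_zero (z := g p) (by
      change tensorMap R π (coverTensor (AlgHom.id k A) (Φ.1 (1 ⊗ₜ[k] p)) -
        1 ⊗ₜ[k] coverMap k R p) = 0
      rw [map_sub, tensorMap_coverTensor_id h, hΦ, coverTensor_tmul,
        Algebra.TensorProduct.map_tmul, sub_eq_zero, map_one]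
      rfl)
    exact ⟨r, hr.symm⟩
  let δ : Cover k R →ₗ[k] R := τ.symm.toLinearMap ∘ₗ g.codRestrict _ hg
  have hδ : ∀ p, ψ p = 1 ⊗ₜ[k] coverMap k R p + t ⊗ₜ[k] δ p := by
    intro p
    have h1 : t ⊗ₜ[k] δ p = ψ p - 1 ⊗ₜ[k] coverMap k R p :=
      congrArg Subtype.val (τ.apply_symm_apply (g.codRestrict _ hg p))
    rw [h1, add_sub_cancel]
  refine ⟨δ, fun a b => h.tmul_injective ?_, fun j => h.tmul_injective ?_⟩
  · have h1 := map_mul ψ a b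
    rw [hδ, hδ, hδ, map_mul] at h1
    simp only [mul_add, add_mul, Algebra.TensorProduct.tmul_mul_tmul, mul_one, one_mul,
      h.mul_self, TensorProduct.zero_tmul, add_zero] at h1
    rw [TensorProduct.mk_apply, TensorProduct.mk_apply, TensorProduct.tmul_add]
    rw [add_assoc] at h1
    rw [add_left_cancel h1, add_comm]
  · have h1 := hδ j
    rw [coverMap_relation, TensorProduct.tmul_zero, zero_add] at h1
    exact (hf j).symm.trans h1

/-- The automorphism `X r ↦ X r + t δ(X r)`, with `δ(X r)` lifted to a variable, covers the identity
and realizes `f`. So the ambiguity is the same for all small extensions, which lets it be moved from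
one to another. -/
theorem IsDerivationRestriction.obs (e : A →ₐ[k] k) {f : Relations k R →ₗ[k] R}
    (hf : IsDerivationRestriction f) : Obs π t (1 : HS k R A') f := by
  obtain ⟨δ, hδ, hf⟩ := hf
  have hδ1 : δ 1 = 0 := by
    have := hδ 1 1
    rw [map_one, mul_one, mul_one, one_mul] at this
    exact left_eq_add.1 this
  let θ : Cover k R →ₐ[k] A ⊗[k] R := AlgHom.ofLinearMap
    (TensorProduct.mk k A R 1 ∘ₗ (coverMap k R).toLinearMap + TensorProduct.mk k A R t ∘ₗ δ)
    (by
      change (1 : A) ⊗ₜ[k] coverMap k R 1 + t ⊗ₜ[k] δ 1 = 1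
      rw [hδ1, TensorProduct.tmul_zero, add_zero, map_one]
      rfl)
    (fun a b => by
      change (1 : A) ⊗ₜ[k] coverMap k R (a * b) + t ⊗ₜ[k] δ (a * b) =
        ((1 : A) ⊗ₜ[k] coverMap k R a + t ⊗ₜ[k] δ a) *
          ((1 : A) ⊗ₜ[k] coverMap k R b + t ⊗ₜ[k] δ b)
      simp only [mul_add, add_mul, Algebra.TensorProduct.tmul_mul_tmul, mul_one, one_mul,
        h.mul_self, TensorProduct.zero_tmul, add_zero, hδ, map_mul, TensorProduct.tmul_add]
      abel)
  have hθ : ∀ p, θ p = 1 ⊗ₜ[k] coverMap k R p + t ⊗ₜ[k] δ p := fun _ => rfl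
  obtain ⟨Φ, hΦ⟩ := exists_hs_cover (R := R) e (fun r => 1 ⊗ₜ[k] MvPolynomial.X r +
    t ⊗ₜ[k] MvPolynomial.X (δ (MvPolynomial.X r))) (fun r => by
      rw [map_add, augment_tmul, augment_tmul, aug_eq_zero e h.mem_maximalIdeal, zero_smul,
        add_zero, map_one, one_smul])
  refine ⟨Φ, covers_of_X _ _ _ fun r => ?_, fun j => ?_⟩
  · rw [hΦ, map_add, coverTensor_tmul, coverTensor_tmul, h.map_t, TensorProduct.zero_tmul,
      add_zero, coverMap_X, map_one]
    rfl
  · have key : (coverTensor (AlgHom.id k A)).comp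
        ((Φ.1.toAlgHom.restrictScalars k).comp Algebra.TensorProduct.includeRight) = θ :=
      MvPolynomial.algHom_ext fun r => by
        change coverTensor (AlgHom.id k A) (Φ.1 (1 ⊗ₜ[k] MvPolynomial.X r)) = _
        rw [hΦ, map_add, coverTensor_tmul, coverTensor_tmul, hθ, coverMap_X, coverMap_X]
        rfl
    refine (DFunLike.congr_fun key (j : Cover k R)).trans ?_
    rw [hθ, coverMap_relation, TensorProduct.tmul_zero, zero_add, hf]

end

end Obstruction

/-! ### Small extensions of monomial algebras -/

/-- Removing from the support an exponent with no proper multiple in it divides out one basis vector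
that every other nonconstant monomial kills. -/
theorem MonomialBasis.isSmall {k : Type u} {A : Type w} {A' : Type w'} {M : Type*} [Field k]
    [CommRing A] [Algebra k A] [CommRing A'] [Algebra k A'] [AddCommMonoid M] [DecidableEq M]
    [IsLocalRing A] [IsArtinianRing A]
    (B : MonomialBasis k A M) (B' : MonomialBasis k A' M) (ρ : A →ₐ[k] A')
    (hρ : ∀ m, ρ (B.mon m) = B'.mon m) (m₀ : M) (h₀ : m₀ ∈ B.supp)
    (hsupp : ∀ m, m ∈ B'.supp ↔ m ∈ B.supp ∧ m ≠ m₀) (hmax : ∀ m, m ≠ 0 → m + m₀ ∉ B.supp) :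
    IsSmall ρ (B.mon m₀) where
  surjective a := by
    refine ⟨∑ m ∈ B'.supp, B'.coeff m a • B.mon m, ?_⟩
    conv_rhs => rw [B'.expand a]
    rw [map_sum]
    refine Finset.sum_congr rfl fun m _ => ?_
    rw [map_smul, hρ]
  map_eq_zero_iff a := by
    constructor
    · intro ha
      have hz : ∀ m ∈ B'.supp, B.coeff m a = 0 := by
        intro m hm
        have h1 := congrArg (B'.coeff m) ha
        rw [B.expand a, map_sum, map_sum, map_zero,
          Finset.sum_eq_single_of_mem m ((hsupp m).1 hm).1] at h1
        · rwa [map_smul, map_smul, hρ, B'.coeff_mon m hm, if_pos rfl, smul_eq_mul, mul_one] at h1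
        · intro n _ hn
          rw [map_smul, map_smul, hρ, B'.coeff_mon m hm, if_neg hn, smul_zero]
      refine ⟨B.coeff m₀ a, ?_⟩
      conv_rhs => rw [B.expand a]
      rw [Finset.sum_eq_single_of_mem m₀ h₀]
      intro m hm hne
      rw [hz m ((hsupp m).2 ⟨hm, hne⟩), zero_smul]
    · rintro ⟨c, rfl⟩
      rw [map_smul, hρ, B'.mon_eq_zero _ fun h => ((hsupp _).1 h).2 rfl, smul_zero]
  ne_zero := B.mon_ne_zero h₀
  mul_eq_zero a ha := by
    rw [B.expand a, Finset.sum_mul]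
    refine Finset.sum_eq_zero fun m _ => ?_
    by_cases hm : m = 0
    · rw [hm, ← B.aug_eq_coeff_zero, aug_eq_zero _ ha, zero_smul, zero_mul]
    · rw [smul_mul_assoc, ← B.mon_add, B.mon_eq_zero _ (hmax m hm), smul_zero]

theorem Truncated.isSmall_trunc (k : Type u) [Field k] (n : ℕ) :
    IsSmall (Truncated.trunc k n) (eps k (n + 1) ^ (n + 1)) := by
  refine MonomialBasis.isSmall (Truncated.basis k (n + 1)) (Truncated.basis k n) _ (fun m => ?_)
    (n + 1) ?_ (fun m => ?_) fun m hm => ?_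
  · change Truncated.trunc k n (eps k (n + 1) ^ m) = eps k n ^ m
    rw [map_pow, Truncated.trunc_eps]
  · exact Finset.mem_range.2 (by omega)
  · change m ∈ Finset.range (n + 1) ↔ m ∈ Finset.range (n + 1 + 1) ∧ m ≠ n + 1
    rw [Finset.mem_range, Finset.mem_range]
    omega
  · change m + (n + 1) ∉ Finset.range (n + 1 + 1)
    rw [Finset.mem_range]
    omega

/-- The staircase of the monomials dividing `x ^ a * y ^ b`. -/
def Staircase.box (a b : ℕ) : Staircase where
  carrier := Finset.range (a + 1) ×ˢ Finset.range (b + 1)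
  zero_mem := by simp
  lower m n h := by
    simp only [Finset.mem_product, Finset.mem_range, Prod.fst_add, Prod.snd_add] at h ⊢
    omega

/-- The staircase of the proper divisors of `x ^ a * y ^ b`. -/
def Staircase.puncturedBox (a b : ℕ) (h : 0 < a) : Staircase where
  carrier := (Finset.range (a + 1) ×ˢ Finset.range (b + 1)).erase (a, b)
  zero_mem := by
    simp only [Finset.mem_erase, Finset.mem_product, Finset.mem_range, Prod.fst_zero,
      Prod.snd_zero, ne_eq, Prod.ext_iff]
    omega
  lower m n h := by
    simp only [Finset.mem_erase, Finset.mem_product, Finset.mem_range, Prod.fst_add,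
      Prod.snd_add, ne_eq, Prod.ext_iff] at h ⊢
    omega

theorem Staircase.mem_box {a b : ℕ} {m : ℕ × ℕ} :
    m ∈ (Staircase.box a b).carrier ↔ m.1 ≤ a ∧ m.2 ≤ b := by
  simp [Staircase.box, Finset.mem_product]

theorem Staircase.mem_puncturedBox {a b : ℕ} {h : 0 < a} {m : ℕ × ℕ} :
    m ∈ (Staircase.puncturedBox a b h).carrier ↔ m ∈ (Staircase.box a b).carrier ∧ m ≠ (a, b) := by
  simp [Staircase.puncturedBox, Staircase.box, and_comm]

/-! ### Additivity defects and commutators of curves -/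

namespace MonomialAlgebra

variable {k : Type u} [Field k] {S : Staircase} {R : Type v} [CommRing R] [Algebra k R] {n l : ℕ}

@[simp]
theorem killRight_fst : killRight k S (mon k S (1, 0)) = mon k S (1, 0) := by
  simp [killRight, lift_mon]

@[simp]
theorem killRight_snd : killRight k S (mon k S (0, 1)) = 0 := by
  simp [killRight, lift_mon]

@[simp]
theorem killLeft_fst : killLeft k S (mon k S (1, 0)) = 0 := by
  simp [killLeft, lift_mon]

@[simp]
theorem killLeft_snd : killLeft k S (mon k S (0, 1)) = mon k S (0, 1) := by
  simp [killLeft, lift_mon]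

theorem box_fst_pow : mon k (Staircase.box n l) (1, 0) ^ (n + 1) = 0 := by
  rw [← mon_eq_zero (k := k) (S := Staircase.box n l) (m := (n + 1, 0))
    (fun hm => by simpa using (Staircase.mem_box.1 hm).1), mon_eq (n + 1, 0), pow_zero, mul_one]

theorem box_snd_pow : mon k (Staircase.box n l) (0, 1) ^ (l + 1) = 0 := by
  rw [← mon_eq_zero (k := k) (S := Staircase.box n l) (m := (0, l + 1))
    (fun hm => by simpa using (Staircase.mem_box.1 hm).2), mon_eq (0, l + 1), pow_zero, one_mul]

theorem exists_boxHom {A : Type w} [CommRing A] [Algebra k A] (y z : A) (hy : y ^ (n + 1) = 0)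
    (hz : z ^ (l + 1) = 0) : ∃ g : MonomialAlgebra k (Staircase.box n l) →ₐ[k] A,
      ∀ m, g (mon k _ m) = y ^ m.1 * z ^ m.2 := by
  refine ⟨lift y z fun m hm => ?_, lift_mon _ _ _⟩
  rw [Staircase.mem_box, not_and_or, not_le, not_le] at hm
  rcases hm with hm | hm
  · rw [pow_eq_zero_of_le hm hy, zero_mul]
  · rw [pow_eq_zero_of_le hm hz, mul_zero]

/-- The failure of a curve to be additive is a product of curves along monomials divisible by
`x y`. -/
theorem additivity_defect_mem (E : HS k R (Truncated k n))
    (fx fy fxy : Truncated k n →ₐ[k] MonomialAlgebra k S) (hx : fx (eps k n) = mon k S (1, 0))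
    (hy : fy (eps k n) = mon k S (0, 1)) (hxy : fxy (eps k n) = mon k S (1, 0) + mon k S (0, 1)) :
    HS.map fxy E * (HS.map fx E)⁻¹ * (HS.map fy E)⁻¹ ∈
      Subgroup.closure ((basis k S).interiorCurves R) := by
  -- Setting `y = 0` turns the curve along `x + y` into the one along `x` and makes the curve along
  -- `y` trivial; setting `x = 0` is symmetric.
  refine mem_closure_interiorCurves _ ?_ ?_
  · rw [map_mul, map_mul, map_inv, map_inv, HS.map_map, HS.map_map, HS.map_map,
      HS.map_eq_one_of_eps ((killRight k S).comp fy) (by simp [hy]), inv_one, mul_one,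
      Truncated.hom_ext (f := (killRight k S).comp fxy) (g := (killRight k S).comp fx)
        (by simp [hx, hxy]), mul_inv_cancel]
  · rw [map_mul, map_mul, map_inv, map_inv, HS.map_map, HS.map_map, HS.map_map,
      HS.map_eq_one_of_eps ((killLeft k S).comp fx) (by simp [hx]), inv_one, mul_one,
      Truncated.hom_ext (f := (killLeft k S).comp fxy) (g := (killLeft k S).comp fy)
        (by simp [hy, hxy]), mul_inv_cancel]

/-- Commutators of curves along the coordinate axes are products of curves along monomials
divisible by `x y`. -/
theorem commutator_mem (E : HS k R (Truncated k n)) (F : HS k R (Truncated k l))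
    (fx : Truncated k n →ₐ[k] MonomialAlgebra k S) (fy : Truncated k l →ₐ[k] MonomialAlgebra k S)
    (hx : fx (eps k n) = mon k S (1, 0)) (hy : fy (eps k l) = mon k S (0, 1)) :
    HS.map fx E * HS.map fy F * (HS.map fx E)⁻¹ * (HS.map fy F)⁻¹ ∈
      Subgroup.closure ((basis k S).interiorCurves R) := by
  refine mem_closure_interiorCurves _ ?_ ?_
  · rw [map_mul, map_mul, map_mul, map_inv, map_inv, HS.map_map, HS.map_map,
      HS.map_eq_one_of_eps ((killRight k S).comp fy) (by simp [hy]), inv_one, mul_one, mul_one,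
      mul_inv_cancel]
  · rw [map_mul, map_mul, map_mul, map_inv, map_inv, HS.map_map, HS.map_map,
      HS.map_eq_one_of_eps ((killLeft k S).comp fx) (by simp [hx]), inv_one, mul_one, one_mul,
      mul_inv_cancel]

end MonomialAlgebra

/-! ### Obstructions of truncated curves -/

section ObsGroup

variable {k : Type u} {R : Type v} [Field k] [CommRing R] [Algebra k R]

variable (k R) in
/-- The obstructions to lifting Hasse-Schmidt derivations of length `n` to length `n + 1`. -/
def obsGroup (n : ℕ) : AddSubgroup (Relations k R →ₗ[k] R) where
  carrier := {f | ∃ E : HS k R (Truncated k n),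
    Obs (Truncated.trunc k n) (eps k (n + 1) ^ (n + 1)) E f}
  zero_mem' := ⟨1, Obs.one (Truncated.isSmall_trunc k n)⟩
  add_mem' := by
    rintro f g ⟨E, hE⟩ ⟨F, hF⟩
    exact ⟨E * F, hE.mul (Truncated.isSmall_trunc k n) (Truncated.aug k _) hF⟩
  neg_mem' := by
    rintro f ⟨E, hE⟩
    exact ⟨E⁻¹, hE.inv (Truncated.isSmall_trunc k n) (Truncated.aug k _)⟩

variable {n l : ℕ}

theorem IsDerivationRestriction.mem_obsGroup {f : Relations k R →ₗ[k] R}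
    (hf : IsDerivationRestriction f) : f ∈ obsGroup k R n :=
  ⟨1, hf.obs (Truncated.isSmall_trunc k n) (Truncated.aug k _)⟩

/-- The substitution `ε ↦ ε ^ d` carries the generator `ε ^ (n + 1)` of one kernel to the generator
`ε ^ (l + 1)` of the other. -/
theorem obsGroup_le_of_dvd (h : n + 1 ∣ l + 1) : obsGroup k R n ≤ obsGroup k R l := by
  obtain ⟨d, hd⟩ := h
  have hd0 : 0 < d := Nat.pos_of_ne_zero fun h => by simp [h] at hd
  rintro f ⟨E, hE⟩
  let g : Truncated k (n + 1) →ₐ[k] Truncated k (l + 1) := Truncated.lift (eps k (l + 1) ^ d) (by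
    rw [← pow_mul]
    refine eps_pow_of_lt k _ ?_
    rw [mul_add, mul_one, mul_comm d, ← hd]
    omega)
  let g' : Truncated k n →ₐ[k] Truncated k l := Truncated.lift (eps k l ^ d) (by
    rw [← pow_mul, mul_comm, ← hd, eps_pow])
  refine ⟨HS.map g' E, ?_⟩
  have := hE.map (ρ := Truncated.trunc k l) (s := eps k (l + 1) ^ (l + 1)) g g'
    (Truncated.hom_ext (by simp [g, g'])) 1 (by
      rw [map_pow, Truncated.lift_eps, ← pow_mul, mul_comm, ← hd, one_smul])
  rwa [one_smul] at this

/-- The substitution `ε ↦ b ε` multiplies obstructions by `b ^ (n + 1)`, and every scalar is such a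
power. -/
theorem smul_mem_obsGroup [IsAlgClosed k] (c : k) {f : Relations k R →ₗ[k] R}
    (hf : f ∈ obsGroup k R n) : c • f ∈ obsGroup k R n := by
  obtain ⟨E, hE⟩ := hf
  obtain ⟨b, hb⟩ := IsAlgClosed.exists_pow_nat_eq c n.succ_pos
  let g : Truncated k (n + 1) →ₐ[k] Truncated k (n + 1) := Truncated.lift (b • eps k (n + 1))
    (by rw [smul_pow, eps_pow, smul_zero])
  let g' : Truncated k n →ₐ[k] Truncated k n := Truncated.lift (b • eps k n)
    (by rw [smul_pow, eps_pow, smul_zero])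
  exact ⟨HS.map g' E, hE.map g g' (Truncated.hom_ext (by simp [g, g'])) c (by
    rw [map_pow, Truncated.lift_eps, smul_pow, hb])⟩

/-- Compare coefficients in `(1 + X)^(p^a u) = (1 + X^(p^a))^u`. -/
theorem choose_prime_pow_mul (p : ℕ) [Fact p.Prime] [CharP k p] (a u : ℕ) :
    (((p ^ a * u).choose (p ^ a) : ℕ) : k) = u := by
  have h1 : ((1 + Polynomial.X : Polynomial k) ^ (p ^ a * u)).coeff (p ^ a) =
      ((p ^ a * u).choose (p ^ a) : ℕ) := Polynomial.coeff_one_add_X_pow k _ _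
  have hp : 0 < p ^ a := pow_pos (Fact.out : p.Prime).pos a
  have h2 : (1 + Polynomial.X : Polynomial k) ^ (p ^ a * u) =
      Polynomial.expand k (p ^ a) ((1 + Polynomial.X) ^ u) := by
    rw [pow_mul, add_pow_char_pow, one_pow, map_pow, map_add, map_one, Polynomial.expand_X]
  have h3 := Polynomial.coeff_expand_mul hp ((1 + Polynomial.X : Polynomial k) ^ u) 1
  rw [one_mul] at h3
  rw [← h1, h2, h3, Polynomial.coeff_one_add_X_pow, Nat.choose_one_right]

open MonomialAlgebra in
/-- Only the `p`-part of the length matters for obstructions. -/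
theorem obsGroup_le_of_prime_pow [IsAlgClosed k] (p : ℕ) [Fact p.Prime] [CharP k p] {a u : ℕ}
    (hl : l + 1 = p ^ a) (hn : n + 1 = (l + 1) * u) (hu : ¬ p ∣ u) :
    obsGroup k R n ≤ obsGroup k R l := by
  rintro f ⟨E, hE⟩
  by_cases hu1 : u = 1
  · have : n = l := by rw [hu1] at hn; omega
    subst this
    exact ⟨E, hE⟩
  obtain ⟨d, rfl⟩ : ∃ d, u = d + 2 := by
    refine ⟨u - 2, ?_⟩
    have : u ≠ 0 := fun h => hu (h ▸ dvd_zero p)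
    omega
  -- The corner `x^(l+1) y^b` has degree `n + 1`. It is the only monomial of that degree in the box,
  -- and it spans the kernel of the box over the punctured box.
  set b := (l + 1) * (d + 1) with hb
  have hnb : n + 1 = (l + 1) + b := by rw [hn, hb]; ring
  have hb0 : l + 1 ≤ b := Nat.le_mul_of_pos_right _ d.succ_pos
  let S := Staircase.box (l + 1) b
  let S' := Staircase.puncturedBox (l + 1) b l.succ_pos
  let x : MonomialAlgebra k S := mon k S (1, 0)
  let y : MonomialAlgebra k S := mon k S (0, 1)
  have hmon : ∀ m : ℕ × ℕ, x ^ m.1 * y ^ m.2 = mon k S m := fun m => (mon_eq m).symm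
  let x' : MonomialAlgebra k S' := mon k S' (1, 0)
  let y' : MonomialAlgebra k S' := mon k S' (0, 1)
  have hmon' : ∀ m : ℕ × ℕ, x' ^ m.1 * y' ^ m.2 = mon k S' m := fun m => (mon_eq m).symm
  let t : MonomialAlgebra k S := mon k S (l + 1, b)
  let π : MonomialAlgebra k S →ₐ[k] MonomialAlgebra k S' := lift x' y' fun m hm => by
    rw [hmon', mon_eq_zero]
    exact fun h => hm (Staircase.mem_puncturedBox.1 h).1
  have hπ : ∀ m, π (mon k S m) = mon k S' m := fun m => (lift_mon _ _ _ m).trans (hmon' m)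
  have hsmall : IsSmall π t := by
    refine MonomialBasis.isSmall (basis k S) (basis k S') π hπ (l + 1, b)
      (Staircase.mem_box.2 ⟨le_rfl, le_rfl⟩) (fun m => Staircase.mem_puncturedBox (h := l.succ_pos)) ?_
    intro m hm hmem
    have := Staircase.mem_box.1 hmem
    refine hm (Prod.ext ?_ ?_)
    · simpa using this.1
    · simpa using this.2
  let e := aug k S
  have hx0 : x ^ (n + 1) = 0 := by
    have := hmon (n + 1, 0)
    rw [pow_zero, mul_one] at this
    rw [this, mon_eq_zero]
    intro h
    have := (Staircase.mem_box.1 h).1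
    dsimp only at this
    omega
  have hy0 : y ^ (n + 1) = 0 := by
    have := hmon (0, n + 1)
    rw [pow_zero, one_mul] at this
    rw [this, mon_eq_zero]
    intro h
    have := (Staircase.mem_box.1 h).2
    dsimp only at this
    omega
  have hxy : (x + y) ^ (n + 1) = ((n + 1).choose (l + 1) : k) • t := by
    rw [add_pow, Finset.sum_eq_single_of_mem (l + 1) (Finset.mem_range.2 (by omega))]
    · rw [show n + 1 - (l + 1) = b by omega, hmon (l + 1, b), Algebra.smul_def, mul_comm,
        map_natCast]
    · intro i hi hne
      have := hmon (i, n + 1 - i)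
      dsimp only at this
      rw [this, mon_eq_zero, zero_mul]
      intro h
      have := Staircase.mem_box.1 h
      dsimp only at this
      omega
  have hxy2 : (x + y) ^ (n + 1 + 1) = 0 := by
    rw [pow_succ, hxy, smul_mul_assoc, mul_comm, hsmall.mul_eq_zero, smul_zero]
    refine mem_maximalIdeal_of_aug e ?_
    rw [map_add, aug_mon (by simp), aug_mon (by simp), add_zero]
  have hxy' : (x' + y') ^ (n + 1) = 0 := by
    have := congrArg π hxy
    rwa [map_pow, map_add, hπ, hπ, map_smul, hsmall.map_t, smul_zero] at this
  let fx : Truncated k n →ₐ[k] MonomialAlgebra k S := Truncated.lift x hx0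
  let fy : Truncated k n →ₐ[k] MonomialAlgebra k S := Truncated.lift y hy0
  let fxy' : Truncated k n →ₐ[k] MonomialAlgebra k S' := Truncated.lift (x' + y') hxy'
  let gxy : Truncated k (n + 1) →ₐ[k] MonomialAlgebra k S := Truncated.lift (x + y) hxy2
  -- First computation: over the punctured box the curve along `x + y` has obstruction a binomial
  -- multiple of `f`, while the curves along `x` and `y` lift to the box. This gives the obstruction
  -- of the defect.
  have hE1 : Obs π t (HS.map fxy' E) (((n + 1).choose (l + 1) : k) • f) :=
    hE.map gxy fxy' (Truncated.hom_ext (by simp [gxy, fxy', x, y, hπ, x', y'])) _ (by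
      rw [map_pow, Truncated.lift_eps, hxy])
  have hG := additivity_defect_mem E (π.comp fx) (π.comp fy) fxy' (by simp [fx, x, hπ])
    (by simp [fy, y, hπ]) (Truncated.lift_eps _ _)
  have hGobs : Obs π t (HS.map fxy' E * (HS.map (π.comp fx) E)⁻¹ * (HS.map (π.comp fy) E)⁻¹)
      (((n + 1).choose (l + 1) : k) • f + -0 + -0) := by
    rw [← HS.map_map, ← HS.map_map]
    exact (hE1.mul hsmall e ((Obs.map_zero hsmall e _).inv hsmall e)).mul hsmall e
      ((Obs.map_zero hsmall e _).inv hsmall e)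
  rw [neg_zero, add_zero, add_zero] at hGobs
  -- Second computation: the defect is a product of interior curves, each of which contributes an
  -- obstruction from length `l`.
  have hclosure : ∀ G ∈ Subgroup.closure ((basis k S').interiorCurves R),
      ∃ f' ∈ obsGroup k R l, Obs π t G f' := by
    intro G hG
    induction hG using Subgroup.closure_induction with
    | mem D hD =>
      obtain ⟨N, w, F, g, hw1, hw2, hgw, rfl⟩ := hD
      change g (eps k N) = mon k S' w at hgw
      have hz := Truncated.eps_map_pow g
      have hpow : ∀ i, mon k S w ^ i = mon k S (i • w) := fun i =>
        ((basis k S).mon_nsmul w i).symm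
      have hnot : (N + 1) • w ∉ S'.carrier := fun h =>
        (basis k S').mon_ne_zero h (by
          rw [MonomialBasis.mon_nsmul]
          change mon k S' w ^ (N + 1) = 0
          rw [← hgw, hz])
      have hπg : ∀ h0 : mon k S w ^ (N + 1) = 0, π.comp (Truncated.lift (mon k S w) h0) = g :=
        fun h0 => Truncated.hom_ext (by simp [hπ, hgw])
      -- An interior curve is obstructed only if its parameter first fails to vanish at the corner.
      -- Then `N + 1` divides `l + 1`, which gives an element of `obsGroup k R l`; otherwise the
      -- curve lifts with the same monomial.
      by_cases hc : (N + 1) • w = (l + 1, b)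
      · obtain ⟨f', hf'⟩ := Obs.exists (Truncated.isSmall_trunc k N) (Truncated.aug k _)
          (Truncated.aug k _) F
        refine ⟨f', obsGroup_le_of_dvd ⟨w.1, ?_⟩ ⟨F, hf'⟩, ?_⟩
        · simpa using (congrArg Prod.fst hc).symm
        · let g₁ : Truncated k (N + 1) →ₐ[k] MonomialAlgebra k S :=
            Truncated.lift (mon k S w) (by
              rw [pow_succ, hpow, hc, mul_comm]
              refine hsmall.mul_eq_zero _ (mem_maximalIdeal_of_aug e (aug_mon ?_))
              rintro rfl
              exact hw1.ne rfl)
          have := hf'.map (ρ := π) (s := t) g₁ g (Truncated.hom_ext (by simp [g₁, hπ, hgw])) 1 (by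
            rw [map_pow, Truncated.lift_eps, hpow, hc, one_smul])
          rwa [one_smul] at this
      · have h0 : mon k S w ^ (N + 1) = 0 := by
          rw [hpow, mon_eq_zero]
          exact fun h => hnot (Staircase.mem_puncturedBox.2 ⟨h, hc⟩)
        refine ⟨0, zero_mem _, ?_⟩
        rw [← hπg h0, ← HS.map_map]
        exact Obs.map_zero hsmall e _
    | one => exact ⟨0, zero_mem _, Obs.one hsmall⟩
    | mul D D' _ _ h h' =>
      obtain ⟨f, hf, hf'⟩ := h
      obtain ⟨g, hg, hg'⟩ := h'
      exact ⟨f + g, add_mem hf hg, hf'.mul hsmall e hg'⟩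
    | inv D _ h =>
      obtain ⟨f, hf, hf'⟩ := h
      exact ⟨-f, neg_mem hf, hf'.inv hsmall e⟩
  obtain ⟨f', hf', hGf'⟩ := hclosure _ hG
  -- The two obstructions of the defect differ by the restriction of a derivation. The binomial
  -- coefficient is `u` in `k`, hence invertible, and is scaled away.
  have hdiff := hGobs.mul hsmall e (hGf'.inv hsmall e)
  rw [mul_inv_cancel] at hdiff
  have hmem := add_mem (hdiff.isDerivationRestriction hsmall e).mem_obsGroup hf'
  rw [neg_add_cancel_right, hn, hl, choose_prime_pow_mul p a (d + 2)] at hmem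
  have hne : ((d + 2 : ℕ) : k) ≠ 0 := fun h => hu ((CharP.cast_eq_zero_iff k p _).1 h)
  have := smul_mem_obsGroup ((d + 2 : ℕ) : k)⁻¹ hmem
  rwa [smul_smul, inv_mul_cancel₀ hne, one_smul] at this

end ObsGroup

/-! ### The subgroup generated by curves -/

section CurveGroup

variable {k : Type u} {R : Type v} [Field k] [CommRing R] [Algebra k R]

section

variable {A : Type w} [CommRing A] [Algebra k A] [IsLocalRing A] [IsArtinianRing A]

variable (k R A) in
/-- The subgroup of `HS^A(R)` generated by the pushforwards of Hasse-Schmidt derivations of finite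
length. -/
def curveGroup : Subgroup (HS k R A) :=
  Subgroup.closure {D | ∃ (n : ℕ) (f : Truncated k n →ₐ[k] A) (E : HS k R (Truncated k n)),
    D = HS.map f E}

theorem map_mem_curveGroup {n : ℕ} (f : Truncated k n →ₐ[k] A) (E : HS k R (Truncated k n)) :
    HS.map f E ∈ curveGroup k R A := Subgroup.subset_closure ⟨n, f, E, rfl⟩

end

variable {A : Type w} {A' : Type w'} [CommRing A] [Algebra k A] [CommRing A'] [Algebra k A']
  [IsLocalRing A] [IsArtinianRing A] [IsLocalRing A'] [IsArtinianRing A']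
  {π : A →ₐ[k] A'} {t : A} (h : IsSmall π t) (e : A →ₐ[k] k) (e' : A' →ₐ[k] k) {n l : ℕ}

/-- A curve lifts without change of length when its parameter has a lift whose `(n + 1)`-st power is
still zero. -/
theorem map_mem_map_curveGroup {f : Truncated k n →ₐ[k] A'} {y : A} (hy : π y = f (eps k n))
    (hy0 : y ^ (n + 1) = 0) (E : HS k R (Truncated k n)) :
    HS.map f E ∈ (curveGroup k R A).map (HS.map π) :=
  ⟨HS.map (Truncated.lift y hy0) E, map_mem_curveGroup _ _, by
    rw [HS.map_map, Truncated.hom_ext (f := π.comp _) (g := f) (by simp [hy])]⟩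

include h

/-- An element which is killed by a small extension is a curve. -/
theorem mem_curveGroup_of_map_eq_one {D : HS k R A} (hD : HS.map π D = 1) :
    D ∈ curveGroup k R A := by
  let τ : R ≃ₗ[k] LinearMap.range (TensorProduct.mk k A R t) :=
    LinearEquiv.ofInjective _ h.tmul_injective
  let ψ : R →ₐ[k] A ⊗[k] R :=
    (D.1.toAlgHom.restrictScalars k).comp Algebra.TensorProduct.includeRight
  let g : R →ₗ[k] A ⊗[k] R := ψ.toLinearMap - TensorProduct.mk k A R 1
  have hg : ∀ p, g p ∈ LinearMap.range (TensorProduct.mk k A R t) := by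
    intro p
    obtain ⟨r, hr⟩ := h.eq_tmul_of_tensorMap_eq_zero (z := g p) (by
      change tensorMap R π (D.1 (1 ⊗ₜ[k] p) - 1 ⊗ₜ[k] p) = 0
      rw [map_sub, ← HS.map_one_tmul, hD, Algebra.TensorProduct.map_tmul, sub_eq_zero, map_one]
      rfl)
    exact ⟨r, hr.symm⟩
  -- `D` is `1 + t δ`; as `t * t = 0`, `δ` is a derivation, so `1 + ε δ` has length `1` and `ε ↦ t`
  -- recovers `D`.
  let δ : R →ₗ[k] R := τ.symm.toLinearMap ∘ₗ g.codRestrict _ hg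
  have hδ : ∀ p, ψ p = 1 ⊗ₜ[k] p + t ⊗ₜ[k] δ p := by
    intro p
    have h1 : t ⊗ₜ[k] δ p = ψ p - 1 ⊗ₜ[k] p :=
      congrArg Subtype.val (τ.apply_symm_apply (g.codRestrict _ hg p))
    rw [h1, add_sub_cancel]
  have hmul : ∀ a b, δ (a * b) = a * δ b + δ a * b := fun a b => h.tmul_injective (by
    have h1 := map_mul ψ a b
    rw [hδ, hδ, hδ] at h1
    simp only [mul_add, add_mul, Algebra.TensorProduct.tmul_mul_tmul, mul_one, one_mul,
      h.mul_self, TensorProduct.zero_tmul, add_zero] at h1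
    rw [TensorProduct.mk_apply, TensorProduct.mk_apply, TensorProduct.tmul_add]
    rw [add_assoc] at h1
    rw [add_left_cancel h1, add_comm])
  have hδ1 : δ 1 = 0 := by
    have := hmul 1 1
    rw [mul_one, mul_one, one_mul] at this
    exact left_eq_add.1 this
  have heps : eps k 1 * eps k 1 = 0 := by rw [← pow_two, eps_pow]
  let θ : R →ₐ[k] Truncated k 1 ⊗[k] R := AlgHom.ofLinearMap
    (TensorProduct.mk k (Truncated k 1) R 1 + TensorProduct.mk k (Truncated k 1) R (eps k 1) ∘ₗ δ)
    (by
      change (1 : Truncated k 1) ⊗ₜ[k] (1 : R) + eps k 1 ⊗ₜ[k] δ 1 = 1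
      rw [hδ1, TensorProduct.tmul_zero, add_zero]
      rfl)
    (fun a b => by
      change (1 : Truncated k 1) ⊗ₜ[k] (a * b) + eps k 1 ⊗ₜ[k] δ (a * b) =
        ((1 : Truncated k 1) ⊗ₜ[k] a + eps k 1 ⊗ₜ[k] δ a) *
          ((1 : Truncated k 1) ⊗ₜ[k] b + eps k 1 ⊗ₜ[k] δ b)
      simp only [mul_add, add_mul, Algebra.TensorProduct.tmul_mul_tmul, mul_one, one_mul,
        heps, TensorProduct.zero_tmul, add_zero, hmul, TensorProduct.tmul_add]
      abel)
  have hθ : ∀ r, θ r = 1 ⊗ₜ[k] r + eps k 1 ⊗ₜ[k] δ r := fun _ => rfl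
  let F : HS k R (Truncated k 1) := HS.lift (Truncated.aug k 1) θ fun r => by
    rw [hθ, map_add, augment_tmul, augment_tmul, map_one, one_smul, Truncated.aug,
      Truncated.lift_eps, zero_smul, add_zero]
  have ht : t ^ (1 + 1) = 0 := by rw [pow_succ, pow_one, h.mul_self]
  have : D = HS.map (Truncated.lift t ht) F := HS.ext fun r => by
    rw [HS.map_one_tmul, HS.lift_one_tmul, hθ, map_add, Algebra.TensorProduct.map_tmul,
      Algebra.TensorProduct.map_tmul, map_one, Truncated.lift_eps]
    exact hδ r
  rw [this]
  exact map_mem_curveGroup _ _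

include e

/-- Products of curves along monomials divisible by both variables become liftable along a small
extension. -/
theorem map_interior_mem (y z : A) (hy : y ∈ IsLocalRing.maximalIdeal A)
    (hz : z ∈ IsLocalRing.maximalIdeal A) (hy0 : π y ^ (n + 1) = 0) (hz0 : π z ^ (l + 1) = 0)
    (g : MonomialAlgebra k (Staircase.box n l) →ₐ[k] A')
    (hg : ∀ m, g (MonomialAlgebra.mon k _ m) = π y ^ m.1 * π z ^ m.2)
    {G : HS k R (MonomialAlgebra k (Staircase.box n l))}
    (hG : G ∈ Subgroup.closure ((MonomialAlgebra.basis k (Staircase.box n l)).interiorCurves R)) :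
    HS.map g G ∈ (curveGroup k R A).map (HS.map π) := by
  have hle : Subgroup.closure
      ((MonomialAlgebra.basis k (Staircase.box n l)).interiorCurves R) ≤
      ((curveGroup k R A).map (HS.map π)).comap (HS.map g) := by
    rw [Subgroup.closure_le]
    rintro D ⟨N, w, F, f, hw1, hw2, hfw, rfl⟩
    change f (eps k N) = MonomialAlgebra.mon k _ w at hfw
    change HS.map g (HS.map f F) ∈ (curveGroup k R A).map (HS.map π)
    rw [HS.map_map]
    refine map_mem_map_curveGroup (y := y ^ w.1 * z ^ w.2) ?_ ?_ F
    · rw [AlgHom.comp_apply, hfw, hg, map_mul, map_pow, map_pow]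
    have hkill : ∀ a ∈ IsLocalRing.maximalIdeal A, ∀ b : A, π b = 0 → a * b = 0 := by
      intro a ha b hb
      obtain ⟨c, rfl⟩ := (h.map_eq_zero_iff b).1 hb
      rw [mul_smul_comm, h.mul_eq_zero a ha, smul_zero]
    have hnot : (N + 1) • w ∉ (Staircase.box n l).carrier := fun hmem => by
      refine (MonomialAlgebra.basis k (Staircase.box n l)).mon_ne_zero hmem ?_
      rw [MonomialBasis.mon_nsmul]
      change MonomialAlgebra.mon k _ w ^ (N + 1) = 0
      rw [← hfw, Truncated.eps_map_pow]
    -- The power leaves the box in one direction, so that factor lies in the kernel `k t`. The other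
    -- factor is in `𝔪_A` because both exponents of `w` are positive; hence the product is already
    -- zero in `A`.
    rw [Staircase.mem_box, not_and_or, not_le, not_le] at hnot
    rw [mul_pow, ← pow_mul, ← pow_mul, mul_comm w.1, mul_comm w.2]
    have p1 : (N + 1) * w.1 ≠ 0 := (Nat.mul_pos N.succ_pos hw1).ne'
    have p2 : (N + 1) * w.2 ≠ 0 := (Nat.mul_pos N.succ_pos hw2).ne'
    rcases hnot with hnot | hnot
    · rw [mul_comm]
      refine hkill _ (Ideal.pow_mem_of_mem _ hz _ (Nat.pos_of_ne_zero p2)) _ ?_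
      rw [map_pow]
      exact pow_eq_zero_of_le hnot hy0
    · refine hkill _ (Ideal.pow_mem_of_mem _ hy _ (Nat.pos_of_ne_zero p1)) _ ?_
      rw [map_pow]
      exact pow_eq_zero_of_le hnot hz0
  exact hle hG

include e'

theorem mem_maximalIdeal_of_map_pow {y : A} (hy : π y ^ (n + 1) = 0) :
    y ∈ IsLocalRing.maximalIdeal A :=
  mem_maximalIdeal_of_aug e (by
    have h1 := congrArg e' hy
    rw [map_pow, map_zero] at h1
    rw [← aug_comp e e' π]
    exact eq_zero_of_pow_eq_zero h1)

/-- Commutators of curves lift to products of curves along a small extension. -/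
theorem commutator_curve_mem (f : Truncated k n →ₐ[k] A') (f' : Truncated k l →ₐ[k] A')
    (E : HS k R (Truncated k n)) (F : HS k R (Truncated k l)) :
    HS.map f E * HS.map f' F * (HS.map f E)⁻¹ * (HS.map f' F)⁻¹ ∈
      (curveGroup k R A).map (HS.map π) := by
  obtain ⟨y, hy⟩ := h.surjective (f (eps k n))
  obtain ⟨z, hz⟩ := h.surjective (f' (eps k l))
  have hy0 : π y ^ (n + 1) = 0 := by rw [hy, Truncated.eps_map_pow]
  have hz0 : π z ^ (l + 1) = 0 := by rw [hz, Truncated.eps_map_pow]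
  obtain ⟨g, hg⟩ := MonomialAlgebra.exists_boxHom (k := k) (π y) (π z) hy0 hz0
  have key := map_interior_mem h e y z (mem_maximalIdeal_of_map_pow h e e' hy0)
    (mem_maximalIdeal_of_map_pow h e e' hz0) hy0 hz0 g hg
    (MonomialAlgebra.commutator_mem E F (Truncated.lift _ MonomialAlgebra.box_fst_pow)
      (Truncated.lift _ MonomialAlgebra.box_snd_pow) (Truncated.lift_eps _ _) (Truncated.lift_eps _ _))
  rw [map_mul, map_mul, map_mul, map_inv, map_inv, HS.map_map, HS.map_map,
    Truncated.hom_ext (f := g.comp (Truncated.lift _ MonomialAlgebra.box_fst_pow)) (g := f)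
      (by simp [hg, hy]),
    Truncated.hom_ext (f := g.comp (Truncated.lift _ MonomialAlgebra.box_snd_pow)) (g := f')
      (by simp [hg, hz])] at key
  exact key

/-- A curve of `p`-power length depends only on the `p`-power of its parameter, modulo curves that
lift along a small extension. -/
theorem curve_mul_inv_curve_mem (p : ℕ) [Fact p.Prime] [CharP k p] {a : ℕ} (hl : l + 1 = p ^ a)
    {y z : A} (hyz : y ^ (l + 1) = z ^ (l + 1)) (f f' : Truncated k l →ₐ[k] A')
    (hf : f (eps k l) = π y) (hf' : f' (eps k l) = π z) (E : HS k R (Truncated k l)) :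
    HS.map f E * (HS.map f' E)⁻¹ ∈ (curveGroup k R A).map (HS.map π) := by
  have : CharP A p := charP_of_injective_algebraMap (algebraMap k A).injective p
  have : CharP (MonomialAlgebra k (Staircase.box l l)) p :=
    charP_of_injective_algebraMap (algebraMap k _).injective p
  -- By Frobenius. Thus the curve along `y - z` lifts to `A`, and the additivity defect for `y = z +
  -- (y - z)` compares the other two curves.
  have hx0 : (y - z) ^ (l + 1) = 0 := by
    rw [hl, sub_pow_char_pow, ← hl, hyz, sub_self]
  have hx0' : π (y - z) ^ (l + 1) = 0 := by rw [← map_pow, hx0, map_zero]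
  have hz0 : π z ^ (l + 1) = 0 := by rw [← hf', Truncated.eps_map_pow]
  obtain ⟨g, hg⟩ := MonomialAlgebra.exists_boxHom (k := k) (π z) (π (y - z)) hz0 hx0'
  have hxy : (MonomialAlgebra.mon k (Staircase.box l l) (1, 0) +
      MonomialAlgebra.mon k (Staircase.box l l) (0, 1)) ^ (l + 1) = 0 := by
    rw [hl, add_pow_char_pow, ← hl, MonomialAlgebra.box_fst_pow, MonomialAlgebra.box_snd_pow, add_zero]
  have key := map_interior_mem h e z (y - z) (mem_maximalIdeal_of_map_pow h e e' hz0)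
    (mem_maximalIdeal_of_map_pow h e e' hx0') hz0 hx0' g hg
    (MonomialAlgebra.additivity_defect_mem E (Truncated.lift _ MonomialAlgebra.box_fst_pow)
      (Truncated.lift _ MonomialAlgebra.box_snd_pow) (Truncated.lift _ hxy)
      (Truncated.lift_eps _ _) (Truncated.lift_eps _ _) (Truncated.lift_eps _ _))
  rw [map_mul, map_mul, map_inv, map_inv, HS.map_map, HS.map_map, HS.map_map,
    Truncated.hom_ext (f := g.comp (Truncated.lift _ MonomialAlgebra.box_fst_pow)) (g := f')
      (by simp [hg, hf']),
    Truncated.hom_ext (f := g.comp (Truncated.lift _ hxy)) (g := f)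
      (by simp [hg, hf])] at key
  have hx : HS.map (g.comp (Truncated.lift _ MonomialAlgebra.box_snd_pow)) E ∈
      (curveGroup k R A).map (HS.map π) :=
    map_mem_map_curveGroup (y := y - z) (by simp [hg]) hx0 E
  have := mul_mem key hx
  rwa [inv_mul_cancel_right] at this

/-- The liftable products of curves form a normal subgroup. -/
theorem normal_map_curveGroup (htop : curveGroup k R A' = ⊤) :
    ((curveGroup k R A).map (HS.map (R := R) π)).Normal := by
  have key : ∀ (n : ℕ) (f : Truncated k n →ₐ[k] A') (E : HS k R (Truncated k n)),
      ∀ x ∈ (curveGroup k R A).map (HS.map (R := R) π),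
        HS.map f E * x * (HS.map f E)⁻¹ ∈ (curveGroup k R A).map (HS.map π) := by
    intro n f E
    rintro _ ⟨d, hd, rfl⟩
    -- It suffices to conjugate one liftable curve, where the conjugate is a commutator times that
    -- curve.
    have hle : curveGroup k R A ≤ (((curveGroup k R A).map (HS.map π)).comap
        (MulAut.conj (HS.map f E)).toMonoidHom).comap (HS.map π) := by
      conv_lhs => rw [curveGroup]
      rw [Subgroup.closure_le]
      rintro _ ⟨l, g, F, rfl⟩
      change HS.map f E * HS.map π (HS.map g F) * (HS.map f E)⁻¹ ∈
        (curveGroup k R A).map (HS.map π)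
      have h1 := commutator_curve_mem h e e' f (π.comp g) E F
      have h2 : HS.map π (HS.map g F) ∈ (curveGroup k R A).map (HS.map π) :=
        ⟨_, map_mem_curveGroup _ _, rfl⟩
      have h3 := mul_mem h1 h2
      rwa [HS.map_map, inv_mul_cancel_right, ← HS.map_map] at h3
    exact hle hd
  rw [← Subgroup.normalizer_eq_top_iff, eq_top_iff, ← htop, curveGroup, Subgroup.closure_le]
  rintro _ ⟨n, f, E, rfl⟩
  rw [SetLike.mem_coe, Subgroup.mem_normalizer_iff]
  refine fun x => ⟨key n f E x, fun hx => ?_⟩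
  have := key n f E⁻¹ _ hx
  rw [map_inv] at this
  convert this using 1
  group

/-- If curves generate `HS^{A'}(R)`, then they generate `HS^A(R)` for a small extension
`A → A'`. -/
theorem curveGroup_eq_top_of_isSmall [IsAlgClosed k] (p : ℕ) [Fact p.Prime] [CharP k p]
    (htop : curveGroup k R A' = ⊤) : curveGroup k R A = ⊤ := by
  have hp1 : 1 < p := (Fact.out : p.Prime).one_lt
  have hnormal := normal_map_curveGroup h e e' htop
  set K := (curveGroup k R A).map (HS.map (R := R) π)
  -- a root of `t` of maximal `p`-power order
  obtain ⟨b, y₀, hy₀, hmax⟩ : ∃ (b : ℕ) (y₀ : A), y₀ ^ p ^ b = t ∧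
      ∀ a (y : A), y ^ p ^ a = t → a ≤ b := by
    obtain ⟨j, hj⟩ := IsArtinianRing.isNilpotent_jacobson_bot (R := A)
    rw [IsLocalRing.jacobson_eq_maximalIdeal ⊥ bot_ne_top] at hj
    have hbound : ∀ a, (∃ y : A, y ^ p ^ a = t) → a ≤ j := by
      rintro a ⟨y, hy⟩
      by_contra hlt
      refine h.ne_zero ?_
      rw [← hy]
      have hym : y ∈ IsLocalRing.maximalIdeal A :=
        Ideal.IsPrime.mem_of_pow_mem inferInstance _ (hy ▸ h.mem_maximalIdeal)
      have h1 := Ideal.pow_mem_pow hym j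
      rw [hj] at h1
      exact pow_eq_zero_of_le ((Nat.lt_pow_self hp1).le.trans
        (Nat.pow_le_pow_right (by omega) (by omega))) h1
    classical
    let P : ℕ → Prop := fun a => ∃ y : A, y ^ p ^ a = t
    have h0 : P 0 := ⟨t, by rw [pow_zero, pow_one]⟩
    obtain ⟨y₀, hy₀⟩ := Nat.findGreatest_spec (P := P) (Nat.zero_le j) h0
    exact ⟨_, y₀, hy₀, fun a y hy => Nat.le_findGreatest (hbound a ⟨y, hy⟩) ⟨y, hy⟩⟩
  obtain ⟨N, hN⟩ : ∃ N, N + 1 = p ^ b := ⟨p ^ b - 1, Nat.sub_add_cancel (Nat.pow_pos (by omega))⟩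
  have hy₀N : y₀ ^ (N + 1) = t := by rw [hN, hy₀]
  have hy₀m : y₀ ∈ IsLocalRing.maximalIdeal A :=
    Ideal.IsPrime.mem_of_pow_mem inferInstance _ (hy₀N ▸ h.mem_maximalIdeal)
  let f₀ : Truncated k N →ₐ[k] A' := Truncated.lift (π y₀) (by rw [← map_pow, hy₀N, h.map_t])
  let g₀ : Truncated k (N + 1) →ₐ[k] A := Truncated.lift y₀ (by
    rw [pow_succ, hy₀N, mul_comm, h.mul_eq_zero _ hy₀m])
  -- Modulo `K`, every curve over `A'` is a curve along `π y₀`.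
  have hsup : K ⊔ (HS.map (R := R) f₀).range = ⊤ := by
    rw [eq_top_iff, ← htop, curveGroup, Subgroup.closure_le]
    rintro _ ⟨n, f, E, rfl⟩
    obtain ⟨y, hy⟩ := h.surjective (f (eps k n))
    obtain ⟨c, hc⟩ := (h.map_eq_zero_iff (y ^ (n + 1))).1 (by
      rw [map_pow, hy, Truncated.eps_map_pow])
    by_cases hc0 : c = 0
    · rw [hc0, zero_smul] at hc
      exact Subgroup.mem_sup_left (map_mem_map_curveGroup hy hc.symm E)
    obtain ⟨b', hb'⟩ := IsAlgClosed.exists_pow_nat_eq c n.succ_pos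
    have hb'0 : b' ≠ 0 := by
      rintro rfl
      rw [zero_pow n.succ_ne_zero] at hb'
      exact hc0 hb'.symm
    -- normalize the parameter
    let z : A := b'⁻¹ • y
    have hz : z ^ (n + 1) = t := by
      rw [smul_pow, ← hc, smul_smul, ← hb', ← mul_pow, inv_mul_cancel₀ hb'0, one_pow, one_smul]
    have hzm : z ∈ IsLocalRing.maximalIdeal A :=
      Ideal.IsPrime.mem_of_pow_mem inferInstance _ (hz ▸ h.mem_maximalIdeal)
    let s : Truncated k n →ₐ[k] Truncated k n := Truncated.lift (b' • eps k n)
      (by rw [smul_pow, eps_pow, smul_zero])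
    let fz : Truncated k n →ₐ[k] A' := Truncated.lift (π z) (by rw [← map_pow, hz, h.map_t])
    have hfz : HS.map f E = HS.map fz (HS.map s E) := by
      rw [HS.map_map, Truncated.hom_ext (f := f) (g := fz.comp s) (by
        simp [fz, s, z, ← hy, smul_smul, mul_inv_cancel₀ hb'0])]
    rw [hfz]
    generalize HS.map s E = E'
    -- pass to the `p`-part of the length
    obtain ⟨a, u, hu, hnu⟩ := Nat.exists_eq_pow_mul_and_not_dvd n.succ_ne_zero p hp1.ne'
    obtain ⟨l, hl⟩ : ∃ l, l + 1 = p ^ a := ⟨p ^ a - 1, Nat.sub_add_cancel (Nat.pow_pos (by omega))⟩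
    have hnu' : n + 1 = (l + 1) * u := by rw [hl]; exact hnu
    obtain ⟨φ, hφ⟩ := Obs.exists (Truncated.isSmall_trunc k n) (Truncated.aug k _)
      (Truncated.aug k _) E'
    -- `F` has length `p^a - 1` and, after `ε ↦ ε ^ u`, the same obstruction as `E'`. The quotient
    -- of the two therefore extends by one step, and `z` can carry the extension since `z ^ (n + 2)
    -- = 0`.
    obtain ⟨F, hF⟩ := obsGroup_le_of_prime_pow (R := R) p hl hnu' hu ⟨E', hφ⟩
    have hu0 : 0 < u := Nat.pos_of_ne_zero fun h => by simp [h] at hnu'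
    let r : Truncated k l →ₐ[k] Truncated k n := Truncated.lift (eps k n ^ u) (by
      rw [← pow_mul, mul_comm, ← hnu', eps_pow])
    let r' : Truncated k (l + 1) →ₐ[k] Truncated k (n + 1) := Truncated.lift (eps k (n + 1) ^ u) (by
      rw [← pow_mul, mul_add, mul_comm, ← hnu']
      exact eps_pow_of_lt k _ (by omega))
    have hrF : Obs (Truncated.trunc k n) (eps k (n + 1) ^ (n + 1)) (HS.map r F) φ := by
      have := hF.map (ρ := Truncated.trunc k n) (s := eps k (n + 1) ^ (n + 1)) r' r
        (Truncated.hom_ext (by simp [r, r'])) 1 (by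
          rw [map_pow, Truncated.lift_eps, ← pow_mul, mul_comm, ← hnu', one_smul])
      rwa [one_smul] at this
    have hlift := hφ.mul (Truncated.isSmall_trunc k n) (Truncated.aug k _)
      (hrF.inv (Truncated.isSmall_trunc k n) (Truncated.aug k _))
    rw [add_neg_cancel] at hlift
    obtain ⟨W, hW⟩ := hlift.exists_lift (Truncated.isSmall_trunc k n) (Truncated.aug k _)
      (Truncated.aug k _)
    let gz : Truncated k (n + 1) →ₐ[k] A := Truncated.lift z (by
      rw [pow_succ, hz, mul_comm, h.mul_eq_zero _ hzm])
    have hWK : HS.map fz (E' * (HS.map r F)⁻¹) ∈ K := by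
      rw [← hW, HS.map_map, Truncated.hom_ext (f := fz.comp (Truncated.trunc k n))
        (g := π.comp gz) (by simp [fz, gz]), ← HS.map_map]
      exact ⟨_, map_mem_curveGroup _ _, rfl⟩
    -- replace the parameter by a power of `y₀`
    have hzu : (z ^ u) ^ (l + 1) = t := by rw [← pow_mul, mul_comm, ← hnu', hz]
    have hab : a ≤ b := hmax a (z ^ u) (by rw [← hl, hzu])
    have hNl : N + 1 = p ^ (b - a) * (l + 1) := by
      rw [hN, hl, ← pow_add, Nat.sub_add_cancel hab]
    -- Maximality of `b` gives `a ≤ b`, so `y₀ ^ p ^ (b - a)` makes sense; its `p^a`-th power is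
    -- `t`, as is that of `z ^ u`.
    let q : Truncated k l →ₐ[k] Truncated k N := Truncated.lift (eps k N ^ p ^ (b - a)) (by
      rw [← pow_mul, ← hNl, eps_pow])
    have hcomp := curve_mul_inv_curve_mem h e e' p hl (y := z ^ u) (z := y₀ ^ p ^ (b - a))
      (by rw [hzu, ← pow_mul, ← hNl, hy₀N]) (fz.comp r) (f₀.comp q) (by simp [fz, r])
      (by simp [f₀, q]) F
    have hfin : HS.map fz E' = HS.map fz (E' * (HS.map r F)⁻¹) *
        (HS.map (fz.comp r) F * (HS.map (f₀.comp q) F)⁻¹) * HS.map f₀ (HS.map q F) := by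
      rw [map_mul, map_inv, HS.map_map, HS.map_map]
      group
    rw [hfin]
    exact mul_mem (mul_mem (Subgroup.mem_sup_left hWK) (Subgroup.mem_sup_left hcomp))
      (Subgroup.mem_sup_right ⟨_, rfl⟩)
  rw [eq_top_iff]
  intro D _
  have hD : HS.map π D ∈ K ⊔ (HS.map (R := R) f₀).range := hsup ▸ Subgroup.mem_top _
  obtain ⟨_, ⟨x, hx, rfl⟩, _, ⟨E, rfl⟩, hxE⟩ := Subgroup.mem_sup_of_normal_left.1 hD
  -- The point of the decomposition: since `x` comes from `A`, so does the curve along `π y₀`.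
  have hE : HS.map f₀ E = HS.map π (x⁻¹ * D) := by
    rw [map_mul, map_inv, ← hxE, inv_mul_cancel_left]
  obtain ⟨φ, hφ⟩ := Obs.exists (Truncated.isSmall_trunc k N) (Truncated.aug k _)
    (Truncated.aug k _) E
  have hφA : Obs π t (HS.map f₀ E) φ := by
    have := hφ.map (ρ := π) (s := t) g₀ f₀ (Truncated.hom_ext (by simp [f₀, g₀])) 1 (by
      rw [map_pow, Truncated.lift_eps, hy₀N, one_smul])
    rwa [one_smul] at this
  have h0 : Obs π t (HS.map f₀ E) 0 := hE ▸ Obs.map_zero h e _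
  -- The obstruction of `E` is also one of a liftable element, so it is the restriction of a
  -- derivation. Hence it can be cancelled over the truncated ring, and `E` extends by one step.
  have hder := hφA.mul h e (h0.inv h e)
  rw [mul_inv_cancel, neg_zero, add_zero] at hder
  have hone := (hder.isDerivationRestriction h e).obs (Truncated.isSmall_trunc k N)
    (Truncated.aug k _)
  have hlift := hφ.mul (Truncated.isSmall_trunc k N) (Truncated.aug k _)
    (hone.inv (Truncated.isSmall_trunc k N) (Truncated.aug k _))
  rw [add_neg_cancel, inv_one, mul_one] at hlift
  obtain ⟨W, hW⟩ := hlift.exists_lift (Truncated.isSmall_trunc k N) (Truncated.aug k _)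
    (Truncated.aug k _)
  have hWE : HS.map π (HS.map g₀ W) = HS.map f₀ E := by
    rw [← hW, HS.map_map, HS.map_map, Truncated.hom_ext (f := π.comp g₀)
      (g := f₀.comp (Truncated.trunc k N)) (by simp [f₀, g₀])]
  -- After removing the curve along `y₀`, what is left of `D` dies in `A'`.
  have hker := mem_curveGroup_of_map_eq_one h (D := x⁻¹ * D * (HS.map g₀ W)⁻¹) (by
    rw [map_mul, map_inv, hWE, ← hE, mul_inv_cancel])
  have := mul_mem (mul_mem hx hker) (map_mem_curveGroup g₀ W)
  convert this using 1
  group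

end CurveGroup

/-! ### Induction over small extensions and brackets of minimal length -/

section Generation

variable {k : Type u} {R : Type v} {A : Type w} [Field k] [CommRing R] [Algebra k R] [CommRing A]
  [Algebra k A] [IsLocalRing A] [IsArtinianRing A]

/-- Any nonzero element of the last nonvanishing power of the maximal ideal will do. -/
theorem exists_socle (h : IsLocalRing.maximalIdeal A ≠ ⊥) :
    ∃ t ∈ IsLocalRing.maximalIdeal A, t ≠ 0 ∧ ∀ a ∈ IsLocalRing.maximalIdeal A, a * t = 0 := by
  have hex : ∃ j, IsLocalRing.maximalIdeal A ^ j = ⊥ := by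
    obtain ⟨j, hj⟩ := IsArtinianRing.isNilpotent_jacobson_bot (R := A)
    rw [IsLocalRing.jacobson_eq_maximalIdeal ⊥ bot_ne_top] at hj
    exact ⟨j, hj⟩
  classical
  obtain ⟨j, hj⟩ : ∃ j, Nat.find hex = j + 2 := by
    refine ⟨Nat.find hex - 2, ?_⟩
    have hs := Nat.find_spec hex
    have h0 : Nat.find hex ≠ 0 := fun h0 => by
      rw [h0, pow_zero, Ideal.one_eq_top] at hs
      exact bot_ne_top hs.symm
    have h1 : Nat.find hex ≠ 1 := fun h1 => by
      rw [h1, pow_one] at hs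
      exact h hs
    omega
  have hs := Nat.find_spec hex
  rw [hj] at hs
  obtain ⟨t, ht, ht0⟩ := Submodule.exists_mem_ne_zero_of_ne_bot
    (Nat.find_min hex (m := j + 1) (by omega))
  refine ⟨t, Ideal.pow_le_self j.succ_ne_zero ht, ht0, fun a ha => ?_⟩
  have h1 := Ideal.mul_mem_mul ha ht
  rw [← pow_succ', hs] at h1
  exact h1

theorem isSmall_quotient (e : A →ₐ[k] k) {t : A}
    (ht : t ≠ 0) (h : ∀ a ∈ IsLocalRing.maximalIdeal A, a * t = 0)
    [IsLocalRing (A ⧸ Ideal.span {t})] :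
    IsSmall (Ideal.Quotient.mkₐ k (Ideal.span {t})) t where
  surjective := Ideal.Quotient.mkₐ_surjective k _
  map_eq_zero_iff a := by
    rw [Ideal.Quotient.mkₐ_eq_mk, Ideal.Quotient.eq_zero_iff_mem, Ideal.mem_span_singleton']
    constructor
    · rintro ⟨b, rfl⟩
      refine ⟨e b, ?_⟩
      have := h (b - algebraMap k A (e b)) (mem_maximalIdeal_of_aug e (by simp))
      rw [sub_mul, sub_eq_zero] at this
      rw [this, Algebra.smul_def]
    · rintro ⟨c, rfl⟩
      exact ⟨algebraMap k A c, (Algebra.smul_def c t).symm⟩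
  ne_zero := ht
  mul_eq_zero := h

/-- Curves generate `HS^B(R)` for every quotient `B` of a local artinian algebra with residue
field `k`. -/
theorem curveGroup_eq_top_of_surjective [IsAlgClosed k] (p : ℕ) [Fact p.Prime] [CharP k p]
    (I : Ideal A) : ∀ (B : Type w) [CommRing B] [Algebra k B] [IsLocalRing B] [IsArtinianRing B]
      (_ : B →ₐ[k] k) (f : A →ₐ[k] B), Function.Surjective f → RingHom.ker f = I →
      curveGroup k R B = ⊤ := by
  -- Noetherian induction in the fixed ring `A`: dividing `B` by a socle element strictly enlarges
  -- the kernel.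
  induction I using WellFoundedGT.induction with
  | ind I ih =>
    intro B _ _ _ _ e f hf hI
    by_cases hm : IsLocalRing.maximalIdeal B = ⊥
    · rw [eq_top_iff]
      intro D _
      have : D = 1 := HS.ext fun r => by
        have h1 := sub_mem_of_reduction_eq (D.2 (1 ⊗ₜ[k] r))
        rw [hm, Submodule.bot_smul, Submodule.mem_bot, sub_eq_zero] at h1
        exact h1
      rw [this]
      exact one_mem _
    · obtain ⟨t, htm, ht, hann⟩ := exists_socle hm
      have hne : Ideal.span {t} ≠ (⊤ : Ideal B) := fun h =>
        (IsLocalRing.mem_maximalIdeal t).1 htm (Ideal.span_singleton_eq_top.1 h)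
      have : Nontrivial (B ⧸ Ideal.span {t}) := Ideal.Quotient.nontrivial_iff.2 hne
      have : IsLocalRing (B ⧸ Ideal.span {t}) :=
        IsLocalRing.of_surjective' (Ideal.Quotient.mk _) Ideal.Quotient.mk_surjective
      have hsmall := isSmall_quotient e ht hann
      let e' : B ⧸ Ideal.span {t} →ₐ[k] k := Ideal.Quotient.liftₐ _ e fun a ha => by
        obtain ⟨b, rfl⟩ := Ideal.mem_span_singleton.1 ha
        rw [map_mul, aug_eq_zero e htm, zero_mul]
      refine curveGroup_eq_top_of_isSmall hsmall e e' p ?_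
      refine ih (RingHom.ker ((Ideal.Quotient.mkₐ k (Ideal.span {t})).comp f)) ?_ _ e' _
        (hsmall.surjective.comp hf) rfl
      rw [← hI, SetLike.lt_iff_le_and_exists]
      refine ⟨fun a ha => ?_, ?_⟩
      · rw [RingHom.mem_ker] at ha ⊢
        rw [AlgHom.comp_apply, ha, map_zero]
      · obtain ⟨a, rfl⟩ := hf t
        exact ⟨a, hsmall.map_t, ht⟩

theorem curveGroup_eq_top [IsAlgClosed k] (p : ℕ) [Fact p.Prime] [CharP k p] (e : A →ₐ[k] k) :
    curveGroup k R A = ⊤ :=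
  curveGroup_eq_top_of_surjective p _ A e (AlgHom.id k A) Function.surjective_id rfl

/-- The augmentation of a local `k`-algebra with residue field `k`. -/
def residueAug (hA : Function.Bijective (algebraMap k (IsLocalRing.ResidueField A))) :
    A →ₐ[k] k :=
  (AlgEquiv.ofBijective (Algebra.ofId k (IsLocalRing.ResidueField A)) hA).symm.toAlgHom.comp
    (IsScalarTower.toAlgHom k A (IsLocalRing.ResidueField A))

theorem le_order {y : A} {n : ℕ} (hy : y ^ (n + 1) = 0) : order y ≤ n := by
  by_cases h : {r : ℕ | y ^ r ≠ 0}.Nonempty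
  · refine csSup_le h fun r hr => ?_
    by_contra hlt
    exact hr (pow_eq_zero_of_le (Nat.not_le.1 hlt) hy)
  · rw [order, Set.not_nonempty_iff_eq_empty.1 h, csSup_empty]
    exact Nat.zero_le n

/-- Every curve is a bracket of minimal length. -/
theorem exists_bracket {n : ℕ} (f : Truncated k n →ₐ[k] A) (E : HS k R (Truncated k n)) :
    ∃ (y : IsLocalRing.maximalIdeal A) (F : Derivation k R (order (y : A))),
      HS.map f E = bracket y le_rfl F := by
  have hy0 := Truncated.eps_map_pow f
  have hym : f (eps k n) ∈ IsLocalRing.maximalIdeal A :=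
    (IsLocalRing.mem_maximalIdeal _).2 fun hu => not_isUnit_zero (hy0 ▸ hu.pow (n + 1))
  let y : IsLocalRing.maximalIdeal A := ⟨_, hym⟩
  have hle : order (y : A) ≤ n := le_order hy0
  -- The order of `y` may be smaller than `n`; the superfluous components are truncated away.
  let r : Truncated k n →ₐ[k] Truncated k (order (y : A)) :=
    Truncated.lift (eps k _) (eps_pow_of_lt k _ (by omega))
  obtain ⟨F, hF⟩ := Derivation.toHS_surjective (HS.map r E)
  refine ⟨y, F, ?_⟩
  change _ = HS.map (evalHom y le_rfl) F.toHS
  rw [hF, HS.map_map]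
  congr 2
  exact Truncated.hom_ext (by
    rw [AlgHom.comp_apply, Truncated.lift_eps, evalHom_eps])

end Generation

end HasseSchmidt

end

theorem theorem3p23 {k : Type*} [Field k] [IsAlgClosed k] (p : ℕ) [Fact p.Prime] [CharP k p]
    {R : Type*} [CommRing R] [Algebra k R] [Algebra.EssFiniteType k R]
    {A : Type*} [CommRing A] [Algebra k A] [IsLocalRing A] [IsArtinianRing A]
    (hA : Function.Bijective (algebraMap k (IsLocalRing.ResidueField A)))
    (D : HasseSchmidt.HS k R A) :
    ∃ (m : ℕ) (y : Fin m → IsLocalRing.maximalIdeal A)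
      (E : ∀ i : Fin m, HasseSchmidt.Derivation k R (HasseSchmidt.order (y i : A))),
      D = (List.ofFn fun i : Fin m => HasseSchmidt.bracket (y i) le_rfl (E i)).prod := by
  have hD : D ∈ HasseSchmidt.curveGroup k R A := by
    rw [HasseSchmidt.curveGroup_eq_top p (HasseSchmidt.residueAug hA)]
    exact Subgroup.mem_top D
  rw [HasseSchmidt.curveGroup, ← Subgroup.mem_toSubmonoid, Subgroup.closure_toSubmonoid] at hD
  obtain ⟨L, hL, rfl⟩ := Submonoid.exists_list_of_mem_closure hD
  have hbracket : ∀ i : Fin L.length, ∃ (y : IsLocalRing.maximalIdeal A)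
      (F : HasseSchmidt.Derivation k R (HasseSchmidt.order (y : A))),
      L.get i = HasseSchmidt.bracket y le_rfl F := by
    intro i
    rcases hL _ (L.get_mem i) with ⟨n, f, E, h⟩ | ⟨n, f, E, h⟩
    · rw [h]
      exact HasseSchmidt.exists_bracket f E
    -- Inverses cost nothing: the inverse of a curve is the curve of the inverse.
    · rw [inv_eq_iff_eq_inv, ← map_inv] at h
      rw [h]
      exact HasseSchmidt.exists_bracket f E⁻¹
  choose y F hyF using hbracket
  refine ⟨L.length, y, F, congrArg List.prod ?_⟩
  rw [← funext hyF]
  exact (List.ofFn_get L).symm
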